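/- **Setting.** Let $\mathcal H=\bigotimes_{i\in\mathbb Z}\mathcal H_i$ with $1\le\dim\mathcal H_i<\infty$, with orthonormal basis the product states $\bigotimes_i|s_i\rangle$, and let $H=\sum_i H_i+\sum_{i<j}H_{ij}$ be a formal sum of self-adjoint operators, where $H_i$ acts on site $i$ only and $H_{ij}$ acts on the sites $i,j$ only, with $\lVert H_{ij}\rVert\le h/|i-j|^{\alpha}$ for all $i<j$ (no bound on the $H_i$). For finite $\Lambda\subset\mathbb Z$ let $H_\Lambda$ be the sum of the terms acting inside $\Lambda$ and $A_\Lambda(t)=e^{\mathrm i H_\Lambda t}Ae^{-\mathrm i H_\Lambda t}$; the size $\lVert[A(t),B]\rVert$ of a commutator with the Heisenberg-evolved operator $A(t)$ of the infinite chain means $\limsup_{\Lambda\to\mathbb Z}\lVert[A_\Lambda(t),B]\rVert$ (which is $\lVert [A(t),B]\rVert$ whenever $A(t)=\lim_\Lambda A_\Lambda(t)$ exists in norm). **Scrambling time.** For an integer $r\ge1$ and $\delta>0$, $t_{\mathrm s}^\delta(r)\in[0,\infty]$ is the largest $T$ such that for all integers $i<j$ with $j-i=r$ and all real $t$ with $0<|t|<T$,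 $$\sup_{A,B}\frac{\lVert[A(t),B]\rVert}{\lVert A\rVert\,\lVert B\rVert}<\delta,$$ where $A\ne 0$ ranges over the bounded operators acting only on sites $\le i$ and $B\ne 0$ over the bounded operators acting only on finitely many sites, all $\ge j$. **Frustration.** Let $R=2^n$, $n\ge1$, and $a\in\mathbb Z$. Number the sites of $[a,a+R-1]$ by $1,\dots,R$ and identify every site $<a$ with number $1$ and every site $>a+R-1$ with number $R$. For $q\ge1$, $k\ge0$ let $\mathcal Q(q,k)$ be the set of pairs $1\le m<n'\le R$ with $2^{q-1}k<m<n'\le 2^{q-1}(k+2)$ that lie in no $\mathcal Q(q',k')$ with $1\le q'<q$, $k'\ge0$. Let $H_{(q,k)}$ be the sum of all $H_{xy}$, $x<y$, for which the numbers of $x$ and $y$ form a pair in $\mathcal Q(q,k)$, and let $\lVert T\rVert_2^2=\operatorname{tr}(T^2)/\dim$ be the normalized trace norm; for an infinite block, $\lVert H_{(q,k)}\rVert$ and $\lVert H_{(q,k)}\rVert_2$ are the suprema of the values for the couplings inside a finite set $\Lambda$, over all $\Lambda$. For $\kappa>0$, $H$ is *frustrated with constant $\kappa$* if every $H_{ij}$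 is a genuine two-body term (its partial traces over $\mathcal H_i$ and over $\mathcal H_j$ vanish) and $\kappa\lVert H_{(q,k)}\rVert\le\lVert H_{(q,k)}\rVert_2$ for all $a,n,q,k$. Put $\alpha'=\alpha$ if $H$ is frustrated with constant $\kappa$, and $\alpha'=\alpha-1$ otherwise. **Theorem.** For all real $\alpha$, $h$, all $\kappa>0$ and all $0<\delta<2$ there is a constant $0<K<\infty$, depending only on $\alpha,h,\kappa,\delta$, such that for every such chain and Hamiltonian and every integer $r\ge1$ ($r\ge2$ if $\alpha'=2$) $$t_{\mathrm s}^\delta(r)\ \ge\ K\times\begin{cases} r^{\alpha'-1}, & 1<\alpha'<2,\\ r(\log r)^{-2}, & \alpha'=2,\\ r, & \alpha'>2.\end{cases}$$ In particular $t_{\mathrm s}^\delta(r)\ge Kr$ if $\alpha>3$, and also if $\alpha>2$ and $H$ is frustrated with constant $\kappa$. -/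

import Mathlib

open scoped ENNReal

noncomputable section

namespace LongRangeChain

/-- Classical configurations of the chain: site `i` has the `d i` basis states `Fin (d i)`. -/
abbrev Conf (d : ℤ → ℕ) : Type := ∀ i : ℤ, Fin (d i)

/-- The Hilbert space of the infinite chain, with orthonormal basis the product states
`⨂ i, |s i⟩` for `s : Conf d`. -/
abbrev ChainSpace (d : ℤ → ℕ) : Type := lp (fun _ : Conf d => ℂ) 2

/-- Bounded operators on the chain. -/
abbrev Op (d : ℤ → ℕ) : Type := ChainSpace d →L[ℂ] ChainSpace d

open Classical in
/-- The product basis vector `⨂ i, |s i⟩`. -/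
def ket {d : ℤ → ℕ} (s : Conf d) : ChainSpace d := lp.single 2 s (1 : ℂ)

/-- The matrix element `⟨s| T |s'⟩`. -/
def entry {d : ℤ → ℕ} (T : Op d) (s s' : Conf d) : ℂ := (T (ket s') : Conf d → ℂ) s

/-- `T = T_S ⊗ 1`: the operator `T` acts on the sites of `S` only. Its matrix elements vanish
between configurations that differ somewhere off `S`, and otherwise depend only on the
restrictions of the two configurations to `S`. -/
def ActsOn {d : ℤ → ℕ} (S : Set ℤ) (T : Op d) : Prop :=
  (∀ s s' : Conf d, (∃ k, k ∉ S ∧ s k ≠ s' k) → entry T s s' = 0) ∧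
  (∀ s s' u u' : Conf d,
    (∀ k ∈ S, s k = u k) → (∀ k ∈ S, s' k = u' k) →
    (∀ k, k ∉ S → s k = s' k) → (∀ k, k ∉ S → u k = u' k) →
    entry T s s' = entry T u u')

/-- The partial trace of `T` over the site `k` vanishes. -/
def TracelessAt {d : ℤ → ℕ} (k : ℤ) (T : Op d) : Prop :=
  ∀ s s' : Conf d,
    ∑ a : Fin (d k), entry T (Function.update s k a) (Function.update s' k a) = 0

/-- The configuration equal to `u` on `Λ` and to the basis state `0` off `Λ`. -/
def extend {d : ℤ → ℕ} [∀ i, NeZero (d i)] (Λ : Finset ℤ) (u : ∀ i : Λ, Fin (d i)) : Conf d :=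
  fun i => if hi : i ∈ Λ then u ⟨i, hi⟩ else 0

/-- For `T` acting on the finite set `Λ`: the trace over the Hilbert space of `Λ`, divided by
the dimension of that space. -/
def normTrace {d : ℤ → ℕ} [∀ i, NeZero (d i)] (Λ : Finset ℤ) (T : Op d) : ℂ :=
  (∑ u : (∀ i : Λ, Fin (d i)), entry T (extend Λ u) (extend Λ u)) / (∏ i ∈ Λ, (d i : ℂ))

/-- For a self-adjoint `T` acting on the finite set `Λ`: `‖T‖₂ = √(tr (T²) / dim)`. -/
def norm2 {d : ℤ → ℕ} [∀ i, NeZero (d i)] (Λ : Finset ℤ) (T : Op d) : ℝ :=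
  √(normTrace Λ (T * T)).re

/-- A 2-local Hamiltonian `∑ i, H_i + ∑ i < j, H_ij` on the chain. (The values `pair i j` with
`j ≤ i` are never used.) -/
structure Hamiltonian (d : ℤ → ℕ) where
  /-- the one-site terms `H_i` -/
  site : ℤ → Op d
  /-- the two-site terms `H_ij`, `i < j` -/
  pair : ℤ → ℤ → Op d
  site_selfAdjoint : ∀ i, IsSelfAdjoint (site i)
  site_actsOn : ∀ i, ActsOn {i} (site i)
  pair_selfAdjoint : ∀ i j, i < j → IsSelfAdjoint (pair i j)
  pair_actsOn : ∀ i j, i < j → ActsOn {i, j} (pair i j)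

namespace Hamiltonian

variable {d : ℤ → ℕ}

/-- `‖H_ij‖ ≤ h / |i - j| ^ α`. -/
def PowerLaw (H : Hamiltonian d) (α h : ℝ) : Prop :=
  ∀ i j : ℤ, i < j → ‖H.pair i j‖ ≤ h / ((j - i : ℤ) : ℝ) ^ α

/-- All terms of the Hamiltonian that act inside the finite set `Λ`. -/
def restrict (H : Hamiltonian d) (Λ : Finset ℤ) : Op d :=
  ∑ i ∈ Λ, H.site i + ∑ p ∈ Λ ×ˢ Λ with p.1 < p.2, H.pair p.1 p.2

/-- The Heisenberg evolution `e^{i t H_Λ} A e^{-i t H_Λ}` by the terms inside `Λ`. -/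
def evolve (H : Hamiltonian d) (Λ : Finset ℤ) (t : ℝ) (A : Op d) : Op d :=
  NormedSpace.exp ((Complex.I * (t : ℂ)) • H.restrict Λ) * A *
    NormedSpace.exp (-((Complex.I * (t : ℂ)) • H.restrict Λ))

/-- `‖[A(t), B]‖ / (‖A‖ ‖B‖)` for the infinite chain, as the thermodynamic limit `Λ → ℤ` of the
evolutions by the terms inside `Λ`. When `A(t) = lim A_Λ(t)` exists in norm this is the ratio for
that `A(t)`; the upper limit makes sense for every bounded `A`, which may act on infinitely many
sites. -/
def commRatio (H : Hamiltonian d) (t : ℝ) (A B : Op d) : ℝ≥0∞ :=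
  Filter.limsup (fun Λ : Finset ℤ =>
    ENNReal.ofReal (‖H.evolve Λ t A * B - B * H.evolve Λ t A‖ / (‖A‖ * ‖B‖))) Filter.atTop

/-- The supremum of the normalized commutator over all bounded `A` that act on the sites `≤ i` and
all bounded `B` that act on finitely many sites, all of them `≥ j`. -/
def growth (H : Hamiltonian d) (i j : ℤ) (t : ℝ) : ℝ≥0∞ :=
  ⨆ (A : Op d) (_ : ActsOn (Set.Iic i) A)
    (B : Op d) (_ : ∃ F : Finset ℤ, (∀ k ∈ F, j ≤ k) ∧ ActsOn (F : Set ℤ) B),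
    H.commRatio t A B

/-- The scrambling time: the largest time `T ∈ [0, ∞]` such that, for all `i < j` at distance `r`,
the normalized commutator stays below `δ` for `0 < |t| < T`. -/
def scramblingTime (H : Hamiltonian d) (δ : ℝ) (r : ℕ) : ℝ≥0∞ :=
  sSup {T : ℝ≥0∞ | ∀ i j : ℤ, i < j → j - i = (r : ℤ) →
    ∀ t : ℝ, 0 < |t| → ENNReal.ofReal |t| < T → H.growth i j t < ENNReal.ofReal δ}

end Hamiltonian

/-- The position of site `x` in the segment of `R` sites which starts at `a`, numbered from `1`
to `R`. All sites to the left are identified with the first site of the segment, all sites to the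
right with its last site. -/
def position (a : ℤ) (R : ℕ) (x : ℤ) : ℤ := max 1 (min (R : ℤ) (x - a + 1))

/-- The pair `m < n` lies in the window `2^(q-1) k < m < n ≤ 2^(q-1) (k+2)`. -/
def InWindow (q k : ℕ) (m n : ℤ) : Prop :=
  2 ^ (q - 1) * (k : ℤ) < m ∧ m < n ∧ n ≤ 2 ^ (q - 1) * ((k : ℤ) + 2)

/-- The pair `1 ≤ m < n ≤ R` belongs to the block `(q, k)`, `q ≥ 1`: it lies in the window
`(q, k)`, and in no window (equivalently, in no block) of a smaller scale. -/
def InBlock (R q k : ℕ) (m n : ℤ) : Prop :=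
  1 ≤ m ∧ n ≤ (R : ℤ) ∧ InWindow q k m n ∧
    ∀ q' k' : ℕ, 1 ≤ q' → q' < q → ¬ InWindow q' k' m n

namespace Hamiltonian

variable {d : ℤ → ℕ}

open Classical in
/-- The block Hamiltonian `H_(q,k)` of the segment of `R` sites which starts at `a`, with the
couplings restricted to the finite set `Λ`. -/
def block (H : Hamiltonian d) (Λ : Finset ℤ) (a : ℤ) (R q k : ℕ) : Op d :=
  ∑ p ∈ Λ ×ˢ Λ with p.1 < p.2 ∧ InBlock R q k (position a R p.1) (position a R p.2),
    H.pair p.1 p.2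

/-- `‖H_(q,k)‖ ∈ [0, ∞]`, for the block with all its (possibly infinitely many) couplings. For the
trace-free couplings to which this is applied, the norms of the restrictions to `Λ` increase
with `Λ`. -/
def blockNorm (H : Hamiltonian d) (a : ℤ) (R q k : ℕ) : ℝ≥0∞ :=
  ⨆ Λ : Finset ℤ, ENNReal.ofReal ‖H.block Λ a R q k‖

/-- `‖H_(q,k)‖₂ ∈ [0, ∞]`, for the block with all its couplings. -/
def blockNorm2 [∀ i, NeZero (d i)] (H : Hamiltonian d) (a : ℤ) (R q k : ℕ) : ℝ≥0∞ :=
  ⨆ Λ : Finset ℤ, ENNReal.ofReal (norm2 Λ (H.block Λ a R q k))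

/-- The Hamiltonian is frustrated with constant `κ`: the two-site terms are genuine two-body
terms (without a scalar or one-body part), and `κ ‖H_(q,k)‖ ≤ ‖H_(q,k)‖₂` for all blocks of all
segments of `2^n` sites, `n ≥ 1`. -/
def FrustratedWith [∀ i, NeZero (d i)] (H : Hamiltonian d) (κ : ℝ) : Prop :=
  (∀ i j : ℤ, i < j → TracelessAt i (H.pair i j) ∧ TracelessAt j (H.pair i j)) ∧
  ∀ (a : ℤ) (n q k : ℕ), 1 ≤ n → 1 ≤ q →
    ENNReal.ofReal κ * H.blockNorm a (2 ^ n) q k ≤ H.blockNorm2 a (2 ^ n) q k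

open Classical in
/-- The effective exponent: `α` if `H` is frustrated with constant `κ`, else `α - 1`. -/
def effExponent [∀ i, NeZero (d i)] (H : Hamiltonian d) (κ α : ℝ) : ℝ :=
  if H.FrustratedWith κ then α else α - 1

end Hamiltonian

end LongRangeChain

end

/-! Sites outside a segment of `2^N ≤ r + 1` positions are identified with its ends. The couplings
between different positions are grouped into dyadic blocks: at scale `q` there are at most
`2^(N-q+1)` blocks, each of length `2^q` and of norm `O(2^(q(1-α'))`). For general couplings the
norm bound is the triangle inequality. For frustrated ones, genuine two-body terms are orthogonal
for the normalized trace, so squares are summed and one power of `2^q` is gained.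

Expand the Heisenberg evolution in words of blocks, and at each scale remember only the records, the
blocks lying to the right of all earlier blocks of that scale. Blocks that are not records stay in
the evolution. With fixed records they form a self-adjoint generator, whose flow is isometric and
costs nothing in norm. Hence a component with `c_q` records at scale `q` has norm at most `‖A‖ ∏
(a_q t)^c_q / c_q!` (`norm_liftFlow_le`), with no factor for the terms that were not recorded. Each
record advances the front of the operator by at most one block length (`adI_block_mem`).

Put a cap on the number of records of each scale. Inclusion-exclusion over the set `T` of saturated
scales writes the evolution as an operator that cannot cross the segment, plus errors labelled by
nonempty `T`. Summing out the scales outside `T` gives the same kind of flow with fewer records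
(`marginal_liftFlow`), so an error costs only the factors `(M_q choose cap_q) (a_q t)^cap_q /
cap_q!` with `q ∈ T` (`exists_near_evolution`).

It remains to divide the segment among the scales. If scale `q` may use a fraction `ρ_q` of it, its
factor is a power of a quantity of order `t 2^(q(2-α')) / (2^N ρ_q²)`. Short scales dominate for `α'
> 2` and long scales for `α' < 2`, and geometric `ρ_q` suffice. At `α' = 2` all scales count
equally, and `ρ_q = 1/(4N)` produces the squared logarithm. -/

namespace LongRangeChain

/-! ### Exponential flows on Banach spaces -/

section Exponential

variable {E F : Type*} [NormedAddCommGroup E] [NormedSpace ℂ E] [CompleteSpace E]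
  [NormedAddCommGroup F] [NormedSpace ℂ F] [CompleteSpace F]

theorem hasSum_exp_apply (T : E →L[ℂ] E) (v : E) :
    HasSum (fun n : ℕ => ((n.factorial : ℂ))⁻¹ • (T ^ n) v) (NormedSpace.exp T v) := by
  have h := NormedSpace.exp_series_hasSum_exp' (𝕂 := ℂ) T
  simpa using h.mapL (ContinuousLinearMap.apply ℂ E v)

/-- A closed subspace which is invariant under `T` is invariant under `exp (c • T)`. -/
theorem exp_smul_apply_mem {p : Submodule ℂ E} (hp : IsClosed (p : Set E)) {T : E →L[ℂ] E}
    (hT : ∀ v ∈ p, T v ∈ p) (c : ℂ) {v : E} (hv : v ∈ p) : NormedSpace.exp (c • T) v ∈ p := by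
  have hn : ∀ n : ℕ, ((c • T) ^ n) v ∈ p := by
    intro n
    induction n with
    | zero => simpa using hv
    | succ n ih => rw [pow_succ']; exact p.smul_mem _ (hT _ ih)
  exact hp.mem_of_tendsto (hasSum_exp_apply (c • T) v)
    (Filter.Eventually.of_forall fun s => p.sum_mem fun n _ => p.smul_mem _ (hn n))

/-- Intertwined generators have intertwined exponentials. -/
theorem map_exp_smul_apply {T : E →L[ℂ] E} {T' : F →L[ℂ] F} {P : E →L[ℂ] F}
    (h : ∀ v, P (T v) = T' (P v)) (c : ℂ) (v : E) :
    P (NormedSpace.exp (c • T) v) = NormedSpace.exp (c • T') (P v) := by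
  have hn : ∀ n : ℕ, P (((c • T) ^ n) v) = ((c • T') ^ n) (P v) := by
    intro n
    induction n with
    | zero => simp
    | succ n ih =>
      rw [pow_succ', pow_succ', mul_apply_eq_comp, mul_apply_eq_comp, ← ih]
      simp [h]
  have h1 := (hasSum_exp_apply (c • T) v).mapL P
  simp only [map_smul, hn] at h1
  exact h1.unique (hasSum_exp_apply (c • T') (P v))

theorem exp_zero_smul_apply (T : E →L[ℂ] E) (v : E) :
    NormedSpace.exp (((0 : ℝ) : ℂ) • T) v = v := by
  simp

theorem hasDerivAt_exp_smul_apply (T : E →L[ℂ] E) (v : E) (t : ℝ) :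
    HasDerivAt (fun u : ℝ => NormedSpace.exp ((u : ℂ) • T) v)
      (T (NormedSpace.exp ((t : ℂ) • T) v)) t := by
  have h := (hasDerivAt_exp_smul_const' (𝕂 := ℂ) T (t : ℂ)).scomp_of_eq t
    (Complex.ofRealCLM.hasDerivAt (x := t)) rfl
  have h2 := ((ContinuousLinearMap.apply ℂ E v).restrictScalars ℝ).hasFDerivAt.comp_hasDerivAt t h
  simpa [Function.comp_def] using h2

end Exponential

/-! ### Heisenberg flows in a C⋆-algebra and Duhamel's bound -/

section Heisenberg

variable {𝒜 : Type*} [CStarAlgebra 𝒜]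

/-- The generator `O ↦ i [h, O]` of the Heisenberg evolution. -/
noncomputable def adI (h : 𝒜) : 𝒜 →L[ℂ] 𝒜 :=
  Complex.I • (ContinuousLinearMap.mul ℂ 𝒜 h - (ContinuousLinearMap.mul ℂ 𝒜).flip h)

theorem adI_apply (h x : 𝒜) : adI h x = Complex.I • (h * x - x * h) := by
  simp [adI]

theorem adI_add (h h' : 𝒜) : adI (h + h') = adI h + adI h' := by
  ext x; simp only [adI_apply, add_apply, ← smul_add]; congr 1; noncomm_ring

theorem adI_zero : adI (0 : 𝒜) = 0 := by
  ext x; simp [adI_apply]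

theorem adI_sum {ι : Type*} (s : Finset ι) (h : ι → 𝒜) :
    adI (∑ i ∈ s, h i) = ∑ i ∈ s, adI (h i) := by
  classical
  induction s using Finset.induction_on with
  | empty => simp [adI_zero]
  | insert a s ha ih => rw [Finset.sum_insert ha, Finset.sum_insert ha, adI_add, ih]

theorem norm_adI_le (h x : 𝒜) : ‖adI h x‖ ≤ 2 * ‖h‖ * ‖x‖ := by
  rw [adI_apply, norm_smul, Complex.norm_I, one_mul]
  have h1 := norm_mul_le h x
  have h2 := norm_mul_le x h
  have := norm_sub_le (h * x) (x * h)
  nlinarith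

/-- The unitary `e^{i t h}`. -/
noncomputable def expI (h : 𝒜) (t : ℝ) : 𝒜 := NormedSpace.exp ((Complex.I * (t : ℂ)) • h)

theorem expI_zero (h : 𝒜) : expI h 0 = 1 := by simp [expI]

theorem expI_mem_unitary {h : 𝒜} (hh : IsSelfAdjoint h) (t : ℝ) : expI h t ∈ unitary 𝒜 := by
  have h1 : IsSelfAdjoint ((t : ℂ) • h) :=
    IsSelfAdjoint.smul (by simp [isSelfAdjoint_iff]) hh
  have := (selfAdjoint.expUnitary ⟨(t : ℂ) • h, h1⟩).2
  rwa [selfAdjoint.expUnitary_coe, smul_smul] at this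

theorem expI_mul_expI_neg (h : 𝒜) (t : ℝ) : expI h t * expI h (-t) = 1 := by
  have hneg : (Complex.I * ((-t : ℝ) : ℂ)) • h = -((Complex.I * (t : ℂ)) • h) := by
    rw [← neg_smul]; push_cast; ring_nf
  let _ : NormedAlgebra ℚ 𝒜 := NormedAlgebra.restrictScalars ℚ ℂ 𝒜
  have hinv := NormedSpace.exp_add_of_commute
    (x := (Complex.I * (t : ℂ)) • h) (y := -((Complex.I * (t : ℂ)) • h)) (Commute.refl _).neg_right
  rw [expI, expI, hneg, ← hinv]; simp

theorem hasDerivAt_expI (h : 𝒜) (t : ℝ) :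
    HasDerivAt (expI h) (Complex.I • (expI h t * h)) t := by
  have h1 := (hasDerivAt_exp_smul_const (𝕂 := ℂ) (Complex.I • h) (t : ℂ)).scomp_of_eq t
    (Complex.ofRealCLM.hasDerivAt (x := t)) rfl
  have h2 : (fun u : ℝ => NormedSpace.exp ((u : ℂ) • Complex.I • h)) = expI h := by
    funext u; simp [expI, smul_smul, mul_comm]
  have h3 : NormedSpace.exp ((t : ℂ) • Complex.I • h) = expI h t := congrFun h2 t
  simp only [Function.comp_def, Complex.ofRealCLM_apply, h2, h3, Complex.ofReal_one, one_smul,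
    mul_smul_comm] at h1
  exact h1

theorem hasDerivAt_expI' (h : 𝒜) (t : ℝ) :
    HasDerivAt (expI h) (Complex.I • (h * expI h t)) t := by
  have hc : Commute h (expI h t) := by
    rw [expI]
    exact ((Commute.refl h).smul_right _).exp_right
  rw [hc.eq]; exact hasDerivAt_expI h t

/-- The interaction picture: conjugation with the inverse flow cancels the commutator term and
leaves only the source `w`. -/
theorem hasDerivAt_conj {h : 𝒜} {v : ℝ → 𝒜} {w : 𝒜} {t : ℝ}
    (hv : HasDerivAt v (adI h (v t) + w) t) :
    HasDerivAt (fun s => expI h (-s) * v s * expI h s) (expI h (-t) * w * expI h t) t := by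
  have h1 : HasDerivAt (fun s => expI h (-s)) (-(Complex.I • (expI h (-t) * h))) t := by
    simpa [Function.comp_def] using (hasDerivAt_expI h (-t)).scomp t (hasDerivAt_neg t)
  have h2 := (h1.mul hv).mul (hasDerivAt_expI' h t)
  refine h2.congr_deriv ?_
  rw [adI_apply]
  simp only [neg_mul, smul_mul_assoc, mul_add, add_mul, mul_smul_comm, mul_sub, sub_mul, smul_sub,
    Pi.mul_apply, mul_assoc]
  abel

theorem norm_conj_eq {h : 𝒜} (hh : IsSelfAdjoint h) (s t : ℝ) (x : 𝒜) :
    ‖expI h s * x * expI h t‖ = ‖x‖ := by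
  rw [CStarRing.norm_mul_mem_unitary _ (expI_mem_unitary hh t),
    CStarRing.norm_mem_unitary_mul _ (expI_mem_unitary hh s)]

/-- Duhamel's bound: the Heisenberg flow contributes nothing to the growth of the norm. -/
theorem norm_le_of_hasDerivAt {h : 𝒜} (hh : IsSelfAdjoint h) {v w : ℝ → 𝒜} {g g' : ℝ → ℝ}
    (hv : ∀ t, HasDerivAt v (adI h (v t) + w t) t) (hg : ∀ t, HasDerivAt g (g' t) t)
    (hw : ∀ t, 0 ≤ t → ‖w t‖ ≤ g' t) (h0 : ‖v 0‖ ≤ g 0) {t : ℝ} (ht : 0 ≤ t) :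
    ‖v t‖ ≤ g t := by
  have key := image_norm_le_of_norm_deriv_right_le_deriv_boundary
    (f := fun s => expI h (-s) * v s * expI h s) (a := 0) (b := t)
    (f' := fun s => expI h (-s) * w s * expI h s)
    (fun s _ => (hasDerivAt_conj (hv s)).continuousAt.continuousWithinAt)
    (fun s _ => (hasDerivAt_conj (hv s)).hasDerivWithinAt) (B := g) (B' := g')
    (by simpa [expI_zero] using h0) hg
    (fun s hs => by rw [norm_conj_eq hh]; exact hw s hs.1) (Set.right_mem_Icc.2 ht)
  rwa [norm_conj_eq hh] at key

/-- Without a source the interaction picture is constant in time. -/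
theorem eq_conj_of_hasDerivAt {h : 𝒜} {v : ℝ → 𝒜}
    (hv : ∀ t, HasDerivAt v (adI h (v t)) t) (t : ℝ) :
    v t = expI h t * v 0 * expI h (-t) := by
  have hd : ∀ s, HasDerivAt (fun s => expI h (-s) * v s * expI h s) 0 s := fun s => by
    have := hasDerivAt_conj (w := 0) (v := v) (h := h) (t := s) (by simpa using hv s)
    simpa using this
  have hc := is_const_of_deriv_eq_zero (fun s => (hd s).differentiableAt)
    (fun s => (hd s).deriv) t 0
  simp only [neg_zero, expI_zero, one_mul, mul_one] at hc
  rw [← hc]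
  have h1 := expI_mul_expI_neg h t
  calc v t = (expI h t * expI h (-t)) * v t * (expI h t * expI h (-t)) := by rw [h1]; simp
    _ = _ := by simp only [mul_assoc]

end Heisenberg

/-! ### The combinatorics of records -/

section Automaton

variable {ι : Type*} [DecidableEq ι] {M : ι → ℕ}

/-- The records of a sequence of blocks: at each scale `q`, the blocks which were to the right of
all earlier blocks of the same scale. -/
abbrev Records (M : ι → ℕ) : Type _ := ∀ q : ι, Finset (Fin (M q))

open Classical in
/-- Reading the block `(q, k)` extends the records of scale `q` if `k` is a new record and fewer
than `cap q` records of that scale have been stored. -/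
noncomputable def Records.step (cap : ι → ℕ) (S : Records M) (b : Σ q, Fin (M q)) : Records M :=
  if (S b.1).card < cap b.1 ∧ ∀ x ∈ S b.1, x < b.2 then
    Function.update S b.1 (insert b.2 (S b.1)) else S

/-- The cap which keeps only the scales in `T`. -/
def capOn (cap : ι → ℕ) (T : Finset ι) (q : ι) : ℕ := if q ∈ T then cap q else 0

/-- Forget the records of the scales outside `T`. -/
def Records.keep (T : Finset ι) (S : Records M) : Records M :=
  fun q => if q ∈ T then S q else ∅

/-- A block of scale `q` reads and changes only the records of scale `q`, so forgetting other scales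
commutes with reading. Cap `0` keeps a forgotten scale empty. -/
theorem Records.keep_step (cap : ι → ℕ) (T : Finset ι) (S : Records M) (b : Σ q, Fin (M q)) :
    (S.step cap b).keep T = (S.keep T).step (capOn cap T) b := by
  obtain ⟨q, k⟩ := b
  unfold Records.step
  by_cases hq : q ∈ T
  · simp only [capOn, Records.keep, hq, if_true]
    split_ifs with h
    · funext q'
      by_cases hqq : q' = q
      · subst hqq; simp [Records.keep, hq]
      · simp [Records.keep, Function.update_of_ne hqq]
    · rfl
  · simp only [capOn, hq, if_false, Nat.not_lt_zero, false_and]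
    split_ifs with h
    · funext q'
      by_cases hqq : q' = q
      · subst hqq; simp [Records.keep, hq]
      · simp [Records.keep, Function.update_of_ne hqq]
    · rfl

theorem Records.card_step_le (cap : ι → ℕ) (S : Records M) (b : Σ q, Fin (M q)) (q : ι) :
    (S q).card ≤ (S.step cap b q).card := by
  obtain ⟨q0, k⟩ := b
  unfold Records.step
  split_ifs with h
  · by_cases hqq : q = q0
    · subst hqq; simpa using Finset.card_le_card (Finset.subset_insert k (S q))
    · simp [Function.update_of_ne hqq]
  · exact le_rfl

theorem Records.step_eq_of_ne {cap : ι → ℕ} {S S' : Records M} {q : ι} {k : Fin (M q)}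
    (h : S.step cap ⟨q, k⟩ = S') (hne : S ≠ S') :
    (S q).card < cap q ∧ (∀ x ∈ S q, x < k) ∧ S' = Function.update S q (insert k (S q)) := by
  unfold Records.step at h
  split_ifs at h with h1
  · exact ⟨h1.1, h1.2, h.symm⟩
  · exact absurd h hne

/-- At each scale, a set of records can be reached in at most one way. -/
theorem Records.step_pred_unique {cap : ι → ℕ} {S S₁ S₂ : Records M} {q : ι} {k₁ k₂ : Fin (M q)}
    (h₁ : S₁.step cap ⟨q, k₁⟩ = S) (n₁ : S₁ ≠ S) (h₂ : S₂.step cap ⟨q, k₂⟩ = S) (n₂ : S₂ ≠ S) :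
    k₁ = k₂ ∧ S₁ = S₂ := by
  obtain ⟨_, l₁, e₁⟩ := Records.step_eq_of_ne h₁ n₁
  obtain ⟨_, l₂, e₂⟩ := Records.step_eq_of_ne h₂ n₂
  have s₁ : S q = insert k₁ (S₁ q) := by rw [e₁]; simp
  have s₂ : S q = insert k₂ (S₂ q) := by rw [e₂]; simp
  -- A block just recorded is the maximum of `S q`; hence `S` determines both it and, after erasing
  -- it, the predecessor.
  have m₁ : k₁ ≤ k₂ := by
    have : k₁ ∈ insert k₂ (S₂ q) := by rw [← s₂, s₁]; simp
    rcases Finset.mem_insert.1 this with h | h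
    · exact h.le
    · exact (l₂ _ h).le
  have m₂ : k₂ ≤ k₁ := by
    have : k₂ ∈ insert k₁ (S₁ q) := by rw [← s₁, s₂]; simp
    rcases Finset.mem_insert.1 this with h | h
    · exact h.le
    · exact (l₁ _ h).le
  have hk : k₁ = k₂ := le_antisymm m₁ m₂
  refine ⟨hk, ?_⟩
  subst hk
  funext q'
  by_cases hq : q' = q
  · subst hq
    have a₁ : S₁ q' = (S q').erase k₁ := by
      rw [s₁, Finset.erase_insert fun h => lt_irrefl _ (l₁ _ h)]
    have a₂ : S₂ q' = (S q').erase k₁ := by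
      rw [s₂, Finset.erase_insert fun h => lt_irrefl _ (l₂ _ h)]
    rw [a₁, a₂]
  · have a₁ : S q' = S₁ q' := by rw [e₁, Function.update_of_ne hq]
    have a₂ : S q' = S₂ q' := by rw [e₂, Function.update_of_ne hq]
    rw [← a₁, a₂]

end Automaton

/-! ### The lift of the evolution to records, and its marginals -/

section Lift

variable {ι : Type*} [DecidableEq ι] [Fintype ι] {M : ι → ℕ}
  {𝒜 : Type*} [CStarAlgebra 𝒜]

/-- The generator `i [h₀ + ∑ h_b, ·]`, lifted to keep track of the records. -/
noncomputable def liftGen (h₀ : 𝒜) (hb : (Σ q, Fin (M q)) → 𝒜) (cap : ι → ℕ) :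
    (Records M → 𝒜) →L[ℂ] (Records M → 𝒜) :=
  ContinuousLinearMap.pi fun S' =>
    (adI h₀).comp (ContinuousLinearMap.proj S') +
      ∑ b : (Σ q, Fin (M q)), ∑ S : Records M with S.step cap b = S',
        (adI (hb b)).comp (ContinuousLinearMap.proj S)

theorem liftGen_apply (h₀ : 𝒜) (hb : (Σ q, Fin (M q)) → 𝒜) (cap : ι → ℕ) (v : Records M → 𝒜)
    (S' : Records M) :
    liftGen h₀ hb cap v S' = adI h₀ (v S') +
      ∑ b : (Σ q, Fin (M q)), ∑ S : Records M with S.step cap b = S', adI (hb b) (v S) := by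
  simp [liftGen]

/-- The part of the Heisenberg evolution of `A` with given records. -/
noncomputable def liftFlow (h₀ : 𝒜) (hb : (Σ q, Fin (M q)) → 𝒜) (cap : ι → ℕ) (A : 𝒜) (t : ℝ) :
    Records M → 𝒜 :=
  NormedSpace.exp ((t : ℂ) • liftGen h₀ hb cap) (Pi.single (fun _ => ∅) A)

theorem liftFlow_zero (h₀ : 𝒜) (hb : (Σ q, Fin (M q)) → 𝒜) (cap : ι → ℕ) (A : 𝒜) :
    liftFlow h₀ hb cap A 0 = Pi.single (fun _ => ∅) A :=
  exp_zero_smul_apply _ _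

/-- Summation over the forgotten records. -/
noncomputable def marginal (T : Finset ι) : (Records M → 𝒜) →L[ℂ] (Records M → 𝒜) :=
  ContinuousLinearMap.pi fun S' =>
    ∑ S : Records M with S.keep T = S', ContinuousLinearMap.proj (R := ℂ) (φ := fun _ => 𝒜) S

theorem marginal_apply (T : Finset ι) (v : Records M → 𝒜) (S' : Records M) :
    marginal T v S' = ∑ S : Records M with S.keep T = S', v S := by
  simp [marginal]

/-- Both sides run over all `S`, sorted by `(S.step cap b).keep T` and by `(S.keep T).step (capOn
cap T) b`, which agree by `Records.keep_step`. -/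
theorem marginal_liftGen (h₀ : 𝒜) (hb : (Σ q, Fin (M q)) → 𝒜) (cap : ι → ℕ) (T : Finset ι)
    (v : Records M → 𝒜) :
    marginal T (liftGen h₀ hb cap v) = liftGen h₀ hb (capOn cap T) (marginal T v) := by
  funext S'
  simp only [marginal_apply, liftGen_apply, map_sum, Finset.sum_add_distrib]
  congr 1
  rw [Finset.sum_comm]
  refine Finset.sum_congr rfl fun b _ => ?_
  have hl : ∑ S₁ : Records M with S₁.keep T = S', ∑ S : Records M with S.step cap b = S₁,
      adI (hb b) (v S) =
      ∑ S : Records M with (S.step cap b).keep T = S', adI (hb b) (v S) := by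
    rw [Finset.sum_filter]
    calc _ = ∑ S₁ : Records M, ∑ S : Records M,
        if S.step cap b = S₁ then if S₁.keep T = S' then adI (hb b) (v S) else 0 else 0 := by
          refine Finset.sum_congr rfl fun S₁ _ => ?_
          split_ifs with h <;> simp [Finset.sum_filter]
      _ = _ := by rw [Finset.sum_comm]; simp [Finset.sum_filter]
  have hr : ∑ S₁ : Records M with S₁.step (capOn cap T) b = S', ∑ S : Records M with S.keep T = S₁,
      adI (hb b) (v S) =
      ∑ S : Records M with (S.keep T).step (capOn cap T) b = S', adI (hb b) (v S) := by
    calc _ = ∑ S₁ : Records M, ∑ S : Records M,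
        if S.keep T = S₁ then if S₁.step (capOn cap T) b = S' then adI (hb b) (v S) else 0
          else 0 := by
          rw [Finset.sum_filter]
          refine Finset.sum_congr rfl fun S₁ _ => ?_
          split_ifs with h <;> simp [Finset.sum_filter]
      _ = _ := by rw [Finset.sum_comm]; simp [Finset.sum_filter]
  rw [hl, hr]
  simp only [Records.keep_step]

theorem marginal_liftFlow (h₀ : 𝒜) (hb : (Σ q, Fin (M q)) → 𝒜) (cap : ι → ℕ) (T : Finset ι)
    (A : 𝒜) (t : ℝ) :
    marginal T (liftFlow h₀ hb cap A t) = liftFlow h₀ hb (capOn cap T) A t := by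
  have h0 : marginal T (Pi.single (fun _ => ∅) A : Records M → 𝒜) = Pi.single (fun _ => ∅) A := by
    funext S'
    rw [marginal_apply, Finset.sum_filter, Finset.sum_eq_single (fun _ => ∅)]
    · have : (Records.keep T (fun _ => ∅ : Records M)) = fun _ => ∅ := by
        funext q; simp [Records.keep]
      rw [this]
      by_cases h : S' = fun _ => ∅
      · subst h; simp
      · rw [if_neg (Ne.symm h), Pi.single_eq_of_ne h]
    · intro S _ hS
      rw [Pi.single_eq_of_ne hS]; simp
    · simp
  have h := map_exp_smul_apply (marginal_liftGen h₀ hb cap T) (t : ℂ)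
    (Pi.single (fun _ => ∅) A : Records M → 𝒜)
  rw [h0] at h
  exact h

end Lift

/-! ### Norm bounds for the components with given records -/

section Lift

variable {ι : Type*} [DecidableEq ι] [Fintype ι] {M : ι → ℕ}
  {𝒜 : Type*} [CStarAlgebra 𝒜]

theorem hasDerivAt_liftFlow (h₀ : 𝒜) (hb : (Σ q, Fin (M q)) → 𝒜) (cap : ι → ℕ) (A : 𝒜) (t : ℝ)
    (S : Records M) :
    HasDerivAt (fun s => liftFlow h₀ hb cap A s S)
      (liftGen h₀ hb cap (liftFlow h₀ hb cap A t) S) t :=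
  hasDerivAt_pi.1 (hasDerivAt_exp_smul_apply (liftGen h₀ hb cap)
    (Pi.single (fun _ => ∅) A : Records M → 𝒜) t) S

/-- The part of the lifted generator which keeps the records `S` is the generator of a Heisenberg
evolution. -/
theorem liftGen_apply_eq (h₀ : 𝒜) (hb : (Σ q, Fin (M q)) → 𝒜) (cap : ι → ℕ)
    (v : Records M → 𝒜) (S : Records M) :
    liftGen h₀ hb cap v S =
      adI (h₀ + ∑ b : (Σ q, Fin (M q)) with S.step cap b = S, hb b) (v S) +
      ∑ b : (Σ q, Fin (M q)), ∑ S' : Records M with S'.step cap b = S ∧ S' ≠ S,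
        adI (hb b) (v S') := by
  rw [liftGen_apply, adI_add, adI_sum, add_apply, sum_apply, add_assoc]
  congr 1
  rw [Finset.sum_filter, ← Finset.sum_add_distrib]
  refine Finset.sum_congr rfl fun b _ => ?_
  rw [← Finset.sum_filter_add_sum_filter_not _ (fun S' => S' = S), Finset.filter_filter,
    Finset.filter_filter]
  congr 1
  split_ifs with h
  · rw [Finset.sum_eq_single S]
    · intro S' hS' hne
      exact absurd (Finset.mem_filter.1 hS').2.2 hne
    · intro hS
      exact absurd (Finset.mem_filter.2 ⟨Finset.mem_univ _, h, rfl⟩) hS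
  · refine Finset.sum_eq_zero fun S' hS' => ?_
    obtain ⟨-, h1, h2⟩ := Finset.mem_filter.1 hS'
    rw [h2] at h1
    exact absurd h1 h

/-- `(a t)^c / c!`, the weight of `c` ordered events of rate `a`. -/
noncomputable def orderedWeight (a : ℝ) (c : ℕ) (t : ℝ) : ℝ := (a * t) ^ c / c.factorial

theorem orderedWeight_nonneg {a t : ℝ} (ha : 0 ≤ a) (ht : 0 ≤ t) (c : ℕ) :
    0 ≤ orderedWeight a c t := by
  unfold orderedWeight; positivity

theorem hasDerivAt_orderedWeight (a : ℝ) (c : ℕ) (t : ℝ) :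
    HasDerivAt (orderedWeight a c) (if c = 0 then 0 else a * orderedWeight a (c - 1) t) t := by
  cases c with
  | zero =>
    have : orderedWeight a 0 = fun _ => 1 := by funext t; simp [orderedWeight]
    rw [this]; simpa using hasDerivAt_const t (1 : ℝ)
  | succ c =>
    have h := (((hasDerivAt_id t).const_mul a).pow (c + 1)).div_const ((c + 1).factorial : ℝ)
    refine (h.congr_deriv ?_)
    simp only [orderedWeight, Nat.succ_ne_zero, if_false, Nat.add_sub_cancel, id, Nat.factorial_succ]
    have := Nat.cast_add_one_ne_zero (R := ℝ) c
    have := Nat.cast_ne_zero (R := ℝ).2 c.factorial_ne_zero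
    push_cast
    field_simp

/-- The part of the evolution with the records `S` is bounded by the weight of `S`. -/
theorem norm_liftFlow_le {h₀ : 𝒜} (hh₀ : IsSelfAdjoint h₀) {hb : (Σ q, Fin (M q)) → 𝒜}
    (hhb : ∀ b, IsSelfAdjoint (hb b)) (cap : ι → ℕ) (A : 𝒜) {a : ι → ℝ}
    (ha : ∀ q k, 2 * ‖hb ⟨q, k⟩‖ ≤ a q) (ha0 : ∀ q, 0 ≤ a q) (S : Records M) {t : ℝ} (ht : 0 ≤ t) :
    ‖liftFlow h₀ hb cap A t S‖ ≤ ‖A‖ * ∏ q, orderedWeight (a q) (S q).card t := by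
  -- Induction on the total number of records: the source of the component `S` comes from
  -- predecessors with one record fewer.
  induction hn : ∑ q, (S q).card using Nat.strong_induction_on generalizing S t with
  | _ n ih =>
  set g' : ℝ → ℝ := fun t => ‖A‖ * ∑ q, (∏ q' ∈ Finset.univ.erase q,
    orderedWeight (a q') (S q').card t) •
      (if (S q).card = 0 then 0 else a q * orderedWeight (a q) ((S q).card - 1) t) with hg'
  -- The blocks which leave `S` unchanged join `h₀` in the isometric part. The majorant `g'` is the
  -- product rule applied to the weight, one summand per scale of the last record.
  refine norm_le_of_hasDerivAt (v := fun s => liftFlow h₀ hb cap A s S)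
    (h := h₀ + ∑ b : (Σ q, Fin (M q)) with S.step cap b = S, hb b)
    (w := fun s => ∑ b : (Σ q, Fin (M q)), ∑ S' : Records M with S'.step cap b = S ∧ S' ≠ S,
        adI (hb b) (liftFlow h₀ hb cap A s S'))
    (g := fun t => ‖A‖ * ∏ q, orderedWeight (a q) (S q).card t) (g' := g')
    (hh₀.add (isSelfAdjoint_sum _ fun b _ => hhb b)) ?_ ?_ ?_ ?_ ht
  · intro s
    have := hasDerivAt_liftFlow h₀ hb cap A s S
    rwa [liftGen_apply_eq] at this
  · intro s
    refine HasDerivAt.const_mul ‖A‖ ?_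
    exact HasDerivAt.fun_finsetProd fun q _ => hasDerivAt_orderedWeight (a q) (S q).card s
  · intro s hs
    have hsplit : ∑ b : (Σ q, Fin (M q)), ∑ S' : Records M with S'.step cap b = S ∧ S' ≠ S,
        adI (hb b) (liftFlow h₀ hb cap A s S') =
        ∑ q, ∑ p : Fin (M q) × Records M with p.2.step cap ⟨q, p.1⟩ = S ∧ p.2 ≠ S,
          adI (hb ⟨q, p.1⟩) (liftFlow h₀ hb cap A s p.2) := by
      rw [Fintype.sum_sigma]
      refine Finset.sum_congr rfl fun q _ => ?_
      rw [Finset.sum_filter, Fintype.sum_prod_type]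
      refine Finset.sum_congr rfl fun k _ => ?_
      rw [Finset.sum_filter]
    rw [hsplit, hg']
    refine (norm_sum_le _ _).trans ?_
    beta_reduce
    rw [Finset.mul_sum]
    refine Finset.sum_le_sum fun q _ => ?_
    have hprod : 0 ≤ ∏ q' ∈ Finset.univ.erase q, orderedWeight (a q') (S q').card s :=
      Finset.prod_nonneg fun q' _ => orderedWeight_nonneg (ha0 q') hs _
    set P := (Finset.univ.filter fun p : Fin (M q) × Records M =>
      p.2.step cap ⟨q, p.1⟩ = S ∧ p.2 ≠ S) with hP
    rcases P.eq_empty_or_nonempty with he | ⟨p, hp⟩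
    · rw [he, Finset.sum_empty, norm_zero]
      have : 0 ≤ (if (S q).card = 0 then 0 else a q * orderedWeight (a q) ((S q).card - 1) s) := by
        split_ifs
        · exact le_rfl
        · exact mul_nonneg (ha0 q) (orderedWeight_nonneg (ha0 q) hs _)
      exact mul_nonneg (norm_nonneg _) (mul_nonneg hprod this)
    -- Only one block and one predecessor lead to `S` at scale `q`, so the rate is that of a single
    -- block and not of all `M q` blocks.
    · have hPp : P = {p} := by
        refine Finset.eq_singleton_iff_unique_mem.2 ⟨hp, fun p' hp' => ?_⟩
        have h1 := (Finset.mem_filter.1 hp).2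
        have h2 := (Finset.mem_filter.1 hp').2
        obtain ⟨h3, h4⟩ := Records.step_pred_unique h2.1 h2.2 h1.1 h1.2
        exact Prod.ext h3 h4
      rw [hPp, Finset.sum_singleton]
      obtain ⟨k, S'⟩ := p
      have h1 := (Finset.mem_filter.1 hp).2
      obtain ⟨-, hlt, hS⟩ := Records.step_eq_of_ne h1.1 h1.2
      have hcard : (S q).card = (S' q).card + 1 := by
        rw [hS, Function.update_self, Finset.card_insert_of_notMem fun h => lt_irrefl _ (hlt _ h)]
      have hother : ∀ q' ∈ Finset.univ.erase q, (S' q').card = (S q').card := fun q' hq' => by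
        rw [hS, Function.update_of_ne (Finset.ne_of_mem_erase hq')]
      have hlt : ∑ q', (S' q').card < n := by
        rw [← hn, ← Finset.add_sum_erase _ _ (Finset.mem_univ q),
          ← Finset.add_sum_erase Finset.univ (fun q => (S q).card) (Finset.mem_univ q), hcard,
          Finset.sum_congr rfl hother]
        omega
      have hb' := ih _ hlt S' hs rfl
      rw [← Finset.mul_prod_erase _ _ (Finset.mem_univ q),
        Finset.prod_congr rfl fun q' hq' => by rw [hother q' hq']] at hb'
      rw [if_neg (by omega), hcard, Nat.add_sub_cancel, smul_eq_mul]
      calc ‖adI (hb ⟨q, k⟩) (liftFlow h₀ hb cap A s S')‖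
          ≤ 2 * ‖hb ⟨q, k⟩‖ * ‖liftFlow h₀ hb cap A s S'‖ := norm_adI_le _ _
        _ ≤ a q * (‖A‖ * (orderedWeight (a q) (S' q).card s *
            ∏ q' ∈ Finset.univ.erase q, orderedWeight (a q') (S q').card s)) :=
          mul_le_mul (ha q k) hb' (norm_nonneg _) (ha0 q)
        _ = _ := by ring
  · rw [liftFlow_zero]
    by_cases hS : S = fun _ => ∅
    · subst hS; simp [orderedWeight]
    · rw [Pi.single_eq_of_ne hS, norm_zero]
      exact mul_nonneg (norm_nonneg _)
        (Finset.prod_nonneg fun q _ => orderedWeight_nonneg (ha0 q) le_rfl _)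

/-- Without records, the lifted flow is the Heisenberg evolution. -/
theorem liftFlow_capOn_empty (h₀ : 𝒜) (hb : (Σ q, Fin (M q)) → 𝒜) (cap : ι → ℕ) (A : 𝒜) (t : ℝ) :
    liftFlow h₀ hb (capOn cap ∅) A t (fun _ => ∅) =
      expI (h₀ + ∑ b, hb b) t * A * expI (h₀ + ∑ b, hb b) (-t) := by
  have hstep : ∀ (S : Records M) (b : Σ q, Fin (M q)), S.step (capOn cap ∅) b = S := by
    intro S b; simp [Records.step, capOn]
  have h := eq_conj_of_hasDerivAt (h := h₀ + ∑ b, hb b)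
    (v := fun s => liftFlow h₀ hb (capOn cap ∅) A s (fun _ => ∅)) (fun s => by
      have h1 := hasDerivAt_liftFlow h₀ hb (capOn cap ∅) A s (fun _ => ∅)
      rw [liftGen_apply_eq] at h1
      simp only [hstep, Finset.filter_true] at h1
      refine h1.congr_deriv ?_
      rw [add_eq_left]
      refine Finset.sum_eq_zero fun b _ => Finset.sum_eq_zero fun S' hS' => ?_
      exact absurd (Finset.mem_filter.1 hS').2.1 (Finset.mem_filter.1 hS').2.2) t
  rw [h, liftFlow_zero, Pi.single_eq_same]

end Lift

/-! ### The front and the approximation by confined operators -/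

section Cone

variable {ι : Type*} [DecidableEq ι] [Fintype ι] {M : ι → ℕ}
  {𝒜 : Type*} [CStarAlgebra 𝒜]

theorem adI_mem_centralizer {s : Set 𝒜} {h x : 𝒜} (hh : h ∈ s.centralizer)
    (hx : x ∈ s.centralizer) : adI h x ∈ s.centralizer := by
  rw [adI_apply]
  rw [← Subalgebra.coe_centralizer ℂ] at *
  exact Subalgebra.smul_mem _ (Subalgebra.sub_mem _ (Subalgebra.mul_mem _ hh hx)
    (Subalgebra.mul_mem _ hx hh)) _

/-- No step exceeds a cap, so the vectors vanishing above the caps form a closed subspace invariant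
under the generator. -/
theorem liftFlow_eq_zero_of_cap_lt (h₀ : 𝒜) (hb : (Σ q, Fin (M q)) → 𝒜) (cap : ι → ℕ) (A : 𝒜)
    (t : ℝ) {S : Records M} {q : ι} (hq : cap q < (S q).card) : liftFlow h₀ hb cap A t S = 0 := by
  let p : Submodule ℂ (Records M → 𝒜) :=
    { carrier := {v | ∀ (S : Records M) (q : ι), cap q < (S q).card → v S = 0}
      zero_mem' := fun _ _ _ => rfl
      add_mem' := fun hv hw S q h => by rw [Pi.add_apply, hv S q h, hw S q h, add_zero]
      smul_mem' := fun c v hv S q h => by rw [Pi.smul_apply, hv S q h, smul_zero] }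
  have hp : IsClosed (p : Set (Records M → 𝒜)) := by
    have : (p : Set (Records M → 𝒜)) =
        ⋂ (S : Records M) (q : ι) (_ : cap q < (S q).card), {v | v S = 0} := by
      ext v; simp [p]
    rw [this]
    exact isClosed_iInter fun S => isClosed_iInter fun q => isClosed_iInter fun _ =>
      isClosed_eq (continuous_apply S) continuous_const
  have hinit : (Pi.single (fun _ => ∅) A : Records M → 𝒜) ∈ p := by
    intro S q h
    have hS : S ≠ fun _ => ∅ := by rintro rfl; simp at h
    rw [Pi.single_eq_of_ne hS]
  refine exp_smul_apply_mem (T := liftGen h₀ hb cap) hp (fun v hv => ?_) t hinit S q hq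
  intro S' q' h
  rw [liftGen_apply, hv S' q' h, map_zero, zero_add]
  refine Finset.sum_eq_zero fun b _ => Finset.sum_eq_zero fun S hS => ?_
  obtain ⟨q₀, k⟩ := b
  have hstep := (Finset.mem_filter.1 hS).2
  by_cases hne : S = S'
  · rw [hne, hv S' q' h, map_zero]
  · obtain ⟨h1, h2, rfl⟩ := Records.step_eq_of_ne hstep hne
    by_cases hqq : q' = q₀
    · subst hqq
      rw [Function.update_self] at h
      have := Finset.card_insert_le k (S q')
      omega
    · rw [Function.update_of_ne hqq] at h
      rw [hv S q' h, map_zero]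

/-- The blocks of a one-dimensional chain, as seen by the operator algebra: `far f` are the
operators to the right of the position `f`, so that the operators up to the position `f` are the
commutant of `far f`. -/
structure BlockChain (M : ι → ℕ) (𝒜 : Type*) [CStarAlgebra 𝒜] where
  /-- the operators to the right of a position -/
  far : ℕ → Set 𝒜
  /-- the terms which do not connect different positions -/
  h₀ : 𝒜
  /-- the blocks -/
  hb : (Σ q, Fin (M q)) → 𝒜
  /-- the length of the blocks of a scale -/
  len : ι → ℕ
  /-- the left end of a block -/
  left : ∀ q, Fin (M q) → ℕ
  /-- the right end of a block -/
  right : ∀ q, Fin (M q) → ℕ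
  selfAdjoint_h₀ : IsSelfAdjoint h₀
  selfAdjoint_hb : ∀ b, IsSelfAdjoint (hb b)
  far_antitone : Antitone far
  adI_h₀_mem : ∀ f, ∀ x ∈ (far f).centralizer, adI h₀ x ∈ (far f).centralizer
  hb_mem : ∀ q k, hb ⟨q, k⟩ ∈ (far (right q k)).centralizer
  hb_commute : ∀ q k, ∀ x ∈ (far (left q k)).centralizer, hb ⟨q, k⟩ * x = x * hb ⟨q, k⟩
  right_le : ∀ q k, right q k ≤ left q k + len q
  right_mono : ∀ q, Monotone (right q)

namespace BlockChain

variable (C : BlockChain M 𝒜)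

/-- The rightmost position which can be reached with given records. -/
def front (S : Records M) : ℕ := 1 + ∑ q, (S q).card * C.len q

theorem mem_centralizer_of_le {f f' : ℕ} (h : f ≤ f') {x : 𝒜} (hx : x ∈ (C.far f).centralizer) :
    x ∈ (C.far f').centralizer :=
  Set.centralizer_subset (C.far_antitone h) hx

/-- The vectors of the lifted space whose component with records `S` does not reach beyond the
front of `S`. -/
def causal (cap : ι → ℕ) : Submodule ℂ (Records M → 𝒜) where
  carrier := {v | ∀ S : Records M, (∀ q, (S q).card < cap q) →
    v S ∈ (C.far (C.front S)).centralizer ∧ ∀ q, ∀ k ∈ S q, C.front S < C.right q k → v S = 0}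
  zero_mem' := fun S _ => ⟨Set.zero_mem_centralizer, fun _ _ _ _ => rfl⟩
  add_mem' := fun {v w} hv hw S hS =>
    ⟨Set.add_mem_centralizer (hv S hS).1 (hw S hS).1, fun q k hk hr => by
      rw [Pi.add_apply, (hv S hS).2 q k hk hr, (hw S hS).2 q k hk hr, add_zero]⟩
  smul_mem' := fun c v hv S hS => by
    refine ⟨?_, fun q k hk hr => by rw [Pi.smul_apply, (hv S hS).2 q k hk hr, smul_zero]⟩
    have := (hv S hS).1
    rw [← Subalgebra.coe_centralizer ℂ] at *
    exact Subalgebra.smul_mem _ this c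

theorem mem_causal {cap : ι → ℕ} {v : Records M → 𝒜} :
    v ∈ C.causal cap ↔ ∀ S : Records M, (∀ q, (S q).card < cap q) →
      v S ∈ (C.far (C.front S)).centralizer ∧
        ∀ q, ∀ k ∈ S q, C.front S < C.right q k → v S = 0 := Iff.rfl

theorem isClosed_causal (cap : ι → ℕ) : IsClosed (C.causal cap : Set (Records M → 𝒜)) := by
  have : (C.causal cap : Set (Records M → 𝒜)) = ⋂ (S : Records M) (_ : ∀ q, (S q).card < cap q),
      ((fun v => v S) ⁻¹' (C.far (C.front S)).centralizer ∩
        ⋂ (q) (k) (_ : k ∈ S q) (_ : C.front S < C.right q k), {v | v S = 0}) := by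
    ext v
    simp only [SetLike.mem_coe, mem_causal, Set.mem_iInter, Set.mem_inter_iff, Set.mem_preimage,
      Set.mem_ofPred_eq]
  rw [this]
  refine isClosed_iInter fun S => isClosed_iInter fun _ => IsClosed.inter ?_ ?_
  · exact (Set.isClosed_centralizer _).preimage (continuous_apply S)
  · exact isClosed_iInter fun q => isClosed_iInter fun k => isClosed_iInter fun _ =>
      isClosed_iInter fun _ => isClosed_eq (continuous_apply S) continuous_const

theorem front_step {cap : ι → ℕ} {S S' : Records M} {q : ι} {k : Fin (M q)}
    (h : S.step cap ⟨q, k⟩ = S') (hne : S ≠ S') : C.front S' = C.front S + C.len q := by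
  obtain ⟨-, hlt, rfl⟩ := Records.step_eq_of_ne h hne
  unfold front
  rw [← Finset.add_sum_erase _ _ (Finset.mem_univ q),
    ← Finset.add_sum_erase Finset.univ (fun q => (S q).card * C.len q) (Finset.mem_univ q),
    Function.update_self, Finset.card_insert_of_notMem fun h => lt_irrefl _ (hlt _ h)]
  have : ∀ q' ∈ Finset.univ.erase q,
      (Function.update S q (insert k (S q)) q').card * C.len q' = (S q').card * C.len q' :=
    fun q' hq' => by rw [Function.update_of_ne (Finset.ne_of_mem_erase hq')]
  rw [Finset.sum_congr rfl this]
  ring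

/-- A block that is not a record ends no further right than some recorded block, so it acts behind
the front. A record starting at or beyond the front commutes with the operator. Any other record
ends within one length of the front, which moves by that length. The second clause of `causal` is
the invariant that recorded blocks end behind the front wherever the component is nonzero. -/
theorem adI_block_mem {cap : ι → ℕ} {v : Records M → 𝒜} (hv : v ∈ C.causal cap)
    {S S' : Records M} {q : ι} {k : Fin (M q)} (hS' : ∀ q, (S' q).card < cap q)
    (h : S.step cap ⟨q, k⟩ = S') :
    adI (C.hb ⟨q, k⟩) (v S) ∈ (C.far (C.front S')).centralizer ∧
      ∀ q', ∀ k' ∈ S' q', C.front S' < C.right q' k' → adI (C.hb ⟨q, k⟩) (v S) = 0 := by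
  have hS : ∀ q, (S q).card < cap q := fun q' =>
    (Records.card_step_le cap S ⟨q, k⟩ q').trans_lt (by rw [h]; exact hS' q')
  obtain ⟨hv1, hv2⟩ := hv S hS
  by_cases hv0 : v S = 0
  · rw [hv0, map_zero]
    exact ⟨Set.zero_mem_centralizer, fun _ _ _ _ => rfl⟩
  have hle : ∀ q, ∀ k ∈ S q, C.right q k ≤ C.front S := fun q k hk => by
    by_contra! hlt
    exact hv0 (hv2 q k hk hlt)
  by_cases hne : S = S'
  · subst hne
    -- As scale `q` is below its cap, only a block that fails to be a record can leave `S`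
    -- unchanged.
    have hk : ∃ x ∈ S q, k ≤ x := by
      by_contra! hlt
      rw [Records.step, if_pos ⟨hS q, hlt⟩] at h
      have h1 : k ∈ S q := by rw [← h]; simp
      exact lt_irrefl _ (hlt k h1)
    obtain ⟨x, hx, hkx⟩ := hk
    refine ⟨adI_mem_centralizer (C.mem_centralizer_of_le
      ((C.right_mono q hkx).trans (hle q x hx)) (C.hb_mem q k)) hv1, fun q' k' hk' hr => ?_⟩
    exact absurd (hle q' k' hk') (not_le.2 hr)
  · have hf := C.front_step h hne
    by_cases hl : C.front S ≤ C.left q k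
    · have : adI (C.hb ⟨q, k⟩) (v S) = 0 := by
        rw [adI_apply, C.hb_commute q k _ (C.mem_centralizer_of_le hl hv1), sub_self, smul_zero]
      rw [this]
      exact ⟨Set.zero_mem_centralizer, fun _ _ _ _ => rfl⟩
    · have hr : C.right q k ≤ C.front S' := by
        have := C.right_le q k
        omega
      refine ⟨adI_mem_centralizer (C.mem_centralizer_of_le hr (C.hb_mem q k))
        (C.mem_centralizer_of_le (by omega) hv1), fun q' k' hk' hlt => ?_⟩
      obtain ⟨-, -, rfl⟩ := Records.step_eq_of_ne h hne
      exfalso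
      by_cases hq : q' = q
      · subst hq
        rw [Function.update_self, Finset.mem_insert] at hk'
        rcases hk' with rfl | hk'
        · omega
        · have := hle _ _ hk'; omega
      · rw [Function.update_of_ne hq] at hk'
        have := hle _ _ hk'; omega

theorem liftGen_mem_causal (cap : ι → ℕ) {v : Records M → 𝒜} (hv : v ∈ C.causal cap) :
    liftGen C.h₀ C.hb cap v ∈ C.causal cap := by
  intro S' hS'
  rw [liftGen_apply]
  constructor
  · rw [← Subalgebra.coe_centralizer ℂ]
    refine Subalgebra.add_mem _ ?_ (Subalgebra.sum_mem _ fun b _ => Subalgebra.sum_mem _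
      fun S hS => ?_)
    · exact C.adI_h₀_mem _ _ (hv S' hS').1
    · exact (C.adI_block_mem hv hS' (Finset.mem_filter.1 hS).2).1
  · intro q k hk hr
    rw [(hv S' hS').2 q k hk hr, map_zero, zero_add]
    refine Finset.sum_eq_zero fun b _ => Finset.sum_eq_zero fun S hS => ?_
    exact (C.adI_block_mem hv hS' (Finset.mem_filter.1 hS).2).2 q k hk hr

theorem liftFlow_mem_causal (cap : ι → ℕ) {A : 𝒜} (hA : A ∈ (C.far 1).centralizer) (t : ℝ) :
    liftFlow C.h₀ C.hb cap A t ∈ C.causal cap := by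
  refine exp_smul_apply_mem (C.isClosed_causal cap) (fun v hv => C.liftGen_mem_causal cap hv) _ ?_
  intro S _
  by_cases hS : S = fun _ => ∅
  · subst hS
    rw [Pi.single_eq_same]
    exact ⟨C.mem_centralizer_of_le (by simp [front]) hA, fun q k hk => by simp at hk⟩
  · rw [Pi.single_eq_of_ne hS]
    exact ⟨Set.zero_mem_centralizer, fun _ _ _ _ => rfl⟩

/-- The records outside `T` are summed before any norm is taken. This leaves as many terms as there
are choices of records at the scales of `T` alone. -/
theorem sum_filter_liftFlow (cap : ι → ℕ) (A : 𝒜) (t : ℝ) (T : Finset ι) :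
    ∑ S : Records M with ∀ q ∈ T, (S q).card = cap q, liftFlow C.h₀ C.hb cap A t S =
      ∑ S ∈ Fintype.piFinset fun q => Finset.powersetCard (capOn cap T q) Finset.univ,
        liftFlow C.h₀ C.hb (capOn cap T) A t S := by
  rw [← marginal_liftFlow]
  simp only [marginal_apply]
  have hmaps : ∀ S ∈ Finset.univ.filter (fun S : Records M => ∀ q ∈ T, (S q).card = cap q),
      S.keep T ∈ Fintype.piFinset fun q =>
        Finset.powersetCard (capOn cap T q) (Finset.univ : Finset (Fin (M q))) := by
    intro S hS
    rw [Fintype.mem_piFinset]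
    intro q
    rw [Finset.mem_powersetCard]
    refine ⟨Finset.subset_univ _, ?_⟩
    by_cases hq : q ∈ T
    · simp [Records.keep, capOn, hq, (Finset.mem_filter.1 hS).2 q hq]
    · simp [Records.keep, capOn, hq]
  rw [← Finset.sum_fiberwise_of_maps_to hmaps]
  refine Finset.sum_congr rfl fun S' hS' => Finset.sum_congr ?_ fun _ _ => rfl
  ext S
  simp only [Finset.mem_filter, Finset.mem_univ, true_and, and_iff_right_iff_imp]
  rintro rfl q hq
  have := (Finset.mem_powersetCard.1 (Fintype.mem_piFinset.1 hS' q)).2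
  simpa [Records.keep, capOn, hq] using this

theorem norm_sum_filter_liftFlow_le (cap : ι → ℕ) (A : 𝒜) {a : ι → ℝ}
    (ha : ∀ q k, 2 * ‖C.hb ⟨q, k⟩‖ ≤ a q) (ha0 : ∀ q, 0 ≤ a q) {t : ℝ} (ht : 0 ≤ t)
    (T : Finset ι) :
    ‖∑ S : Records M with ∀ q ∈ T, (S q).card = cap q, liftFlow C.h₀ C.hb cap A t S‖ ≤
      ‖A‖ * ∏ q ∈ T, ((M q).choose (cap q) * orderedWeight (a q) (cap q) t) := by
  rw [sum_filter_liftFlow]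
  refine (norm_sum_le_of_le _ (n := fun _ => ‖A‖ * ∏ q, orderedWeight (a q) (capOn cap T q) t)
    fun S hS => ?_).trans ?_
  · refine (norm_liftFlow_le C.selfAdjoint_h₀ C.selfAdjoint_hb _ A ha ha0 S ht).trans_eq ?_
    congr 1
    refine Finset.prod_congr rfl fun q _ => ?_
    rw [(Finset.mem_powersetCard.1 (Fintype.mem_piFinset.1 hS q)).2]
  · rw [Finset.sum_const, Fintype.card_piFinset, nsmul_eq_mul, Nat.cast_prod, mul_left_comm,
      ← Finset.prod_mul_distrib, ← Finset.prod_subset (Finset.subset_univ T)]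
    · refine le_of_eq ?_
      congr 1
      refine Finset.prod_congr rfl fun q hq => ?_
      simp [capOn, hq]
    · intro q _ hq
      simp [capOn, hq, orderedWeight]

/-- The Heisenberg evolution of an operator at the position `1` is close to an operator which has
only moved by fewer than `cap q` blocks at each scale `q`. -/
theorem exists_near_evolution (cap : ι → ℕ) {A : 𝒜}
    (hA : A ∈ (C.far 1).centralizer) {a : ι → ℝ} (ha : ∀ q k, 2 * ‖C.hb ⟨q, k⟩‖ ≤ a q)
    (ha0 : ∀ q, 0 ≤ a q) {t : ℝ} (ht : 0 ≤ t) :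
    ∃ X ∈ (C.far (1 + ∑ q, (cap q - 1) * C.len q)).centralizer,
      ‖expI (C.h₀ + ∑ b, C.hb b) t * A * expI (C.h₀ + ∑ b, C.hb b) (-t) - X‖ ≤
        ‖A‖ * (∏ q, (1 + (M q).choose (cap q) * orderedWeight (a q) (cap q) t) - 1) := by
  classical
  set v := liftFlow C.h₀ C.hb cap A t with hv
  have hcaus := C.liftFlow_mem_causal cap hA t
  set Y : Finset ι → 𝒜 := fun T => ∑ S : Records M with ∀ q ∈ T, (S q).card = cap q, v S with hY
  have hY0 : Y ∅ = expI (C.h₀ + ∑ b, C.hb b) t * A * expI (C.h₀ + ∑ b, C.hb b) (-t) := by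
    rw [← liftFlow_capOn_empty C.h₀ C.hb cap A t, hY, hv]
    beta_reduce
    rw [sum_filter_liftFlow, Finset.sum_eq_single fun _ => ∅]
    · intro S hS hne
      refine absurd ?_ hne
      funext q
      have := (Finset.mem_powersetCard.1 (Fintype.mem_piFinset.1 hS q)).2
      simpa [capOn] using this
    · intro h
      refine absurd ?_ h
      simp [capOn]
  -- The coefficient is `1` if no scale has reached its cap and `0` otherwise. Expanding the product
  -- gives the alternating sum over sets `T` of saturated scales, whose term `T = ∅` is the full
  -- evolution.
  set X := ∑ S : Records M, (∏ q, (1 - (if (S q).card = cap q then (1 : ℂ) else 0))) • v S with hX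
  have hXY : X = ∑ T : Finset ι, (-1 : ℂ) ^ T.card • Y T := by
    simp only [hX, hY, sub_eq_add_neg, Finset.prod_one_add, Finset.powerset_univ,
      Finset.sum_smul]
    rw [Finset.sum_comm]
    refine Finset.sum_congr rfl fun T _ => ?_
    rw [Finset.sum_filter, Finset.smul_sum]
    refine Finset.sum_congr rfl fun S _ => ?_
    rw [Finset.prod_neg, Finset.prod_ite_zero]
    split_ifs <;> simp
  have hsum : ∏ q, (1 + (M q).choose (cap q) * orderedWeight (a q) (cap q) t) - 1 =
      ∑ T ∈ Finset.univ.erase (∅ : Finset ι),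
        ∏ q ∈ T, ((M q).choose (cap q) * orderedWeight (a q) (cap q) t) := by
    rw [Finset.prod_one_add, Finset.powerset_univ,
      ← Finset.add_sum_erase _ _ (Finset.mem_univ (∅ : Finset ι))]
    simp
  refine ⟨X, ?_, ?_⟩
  · rw [hX, ← Subalgebra.coe_centralizer ℂ]
    refine Subalgebra.sum_mem _ fun S _ => ?_
    -- Below all caps the component is causal; at a cap its coefficient vanishes; beyond a cap the
    -- component itself vanishes.
    by_cases hS : ∀ q, (S q).card < cap q
    · refine Subalgebra.smul_mem _ ?_ _
      refine C.mem_centralizer_of_le ?_ (hcaus S hS).1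
      refine Nat.add_le_add_left (Finset.sum_le_sum fun q _ => Nat.mul_le_mul_right _ ?_) 1
      have := hS q
      omega
    · by_cases hS' : ∃ q, (S q).card = cap q
      · obtain ⟨q, hq⟩ := hS'
        rw [Finset.prod_eq_zero (Finset.mem_univ q) (by simp [hq]), zero_smul]
        exact Subalgebra.zero_mem _
      · push Not at hS hS'
        obtain ⟨q, hq⟩ := hS
        rw [hv, liftFlow_eq_zero_of_cap_lt _ _ _ _ _ (lt_of_le_of_ne hq (hS' q).symm), smul_zero]
        exact Subalgebra.zero_mem _
  · rw [← hY0, hXY, ← Finset.add_sum_erase _ _ (Finset.mem_univ (∅ : Finset ι)), hsum,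
      Finset.card_empty, pow_zero, one_smul, sub_add_cancel_left, norm_neg, Finset.mul_sum]
    refine norm_sum_le_of_le _ fun T _ => ?_
    rw [norm_smul, norm_pow, norm_neg, norm_one, one_pow, one_mul]
    exact C.norm_sum_filter_liftFlow_le cap A ha ha0 ht T

end BlockChain

end Cone

/-! ### Matrix elements and supports of operators -/

section Entries

variable {d : ℤ → ℕ}

theorem norm_ket (s : Conf d) : ‖ket s‖ = 1 := by
  classical
  rw [ket, lp.norm_single (by norm_num), norm_one]

theorem norm_entry_le (T : Op d) (s s' : Conf d) : ‖entry T s s'‖ ≤ ‖T‖ := by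
  refine (lp.norm_apply_le_norm (by norm_num) (T (ket s')) s).trans ?_
  simpa [norm_ket] using T.le_opNorm (ket s')

theorem hasSum_smul_ket (f : ChainSpace d) : HasSum (fun s => (f : Conf d → ℂ) s • ket s) f := by
  classical
  have h := lp.hasSum_single (p := 2) (by norm_num) f
  convert h using 2 with s
  rw [ket, ← lp.single_smul, smul_eq_mul, mul_one]

/-- Evaluation of a vector at a configuration. -/
noncomputable def coord (s : Conf d) : ChainSpace d →L[ℂ] ℂ :=
  LinearMap.mkContinuous
    { toFun := fun f => (f : Conf d → ℂ) s
      map_add' := fun _ _ => rfl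
      map_smul' := fun _ _ => rfl } 1
    fun f => by rw [one_mul]; exact lp.norm_apply_le_norm (by norm_num) f s

theorem coord_apply (s : Conf d) (f : ChainSpace d) : coord s f = (f : Conf d → ℂ) s := rfl

theorem hasSum_entry_mul (T T' : Op d) (s s' : Conf d) :
    HasSum (fun u => entry T s u * entry T' u s') (entry (T * T') s s') := by
  have h := ((hasSum_smul_ket (T' (ket s'))).mapL T).mapL (coord s)
  simp only [map_smul, coord_apply, smul_eq_mul] at h
  simp only [mul_comm (entry T s _)]
  exact h

theorem op_ext {T T' : Op d} (h : ∀ s s', entry T s s' = entry T' s s') : T = T' := by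
  ext1 f
  have hk : ∀ s', T (ket s') = T' (ket s') := fun s' => lp.ext (funext fun s => h s s')
  have h1 := (hasSum_smul_ket f).mapL T
  have h2 := (hasSum_smul_ket f).mapL T'
  simp only [map_smul, hk] at h1 h2
  exact h1.unique h2

theorem entry_add (T T' : Op d) (s s' : Conf d) :
    entry (T + T') s s' = entry T s s' + entry T' s s' := rfl

theorem entry_zero (s s' : Conf d) : entry (0 : Op d) s s' = 0 := rfl

theorem ActsOn.mono {S S' : Set ℤ} (h : S ⊆ S') {T : Op d} (hT : ActsOn S T) : ActsOn S' T := by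
  refine ⟨fun s s' ⟨k, hk, hne⟩ => hT.1 s s' ⟨k, fun hk' => hk (h hk'), hne⟩, ?_⟩
  intro s s' u u' h1 h2 h3 h4
  by_cases hs : ∃ k, k ∉ S ∧ s k ≠ s' k
  · obtain ⟨k, hk, hne⟩ := hs
    have hkS' : k ∈ S' := by
      by_contra hk'
      exact hne (h3 k hk')
    rw [hT.1 s s' ⟨k, hk, hne⟩, hT.1 u u' ⟨k, hk, by rwa [← h1 k hkS', ← h2 k hkS']⟩]
  · push Not at hs
    refine hT.2 s s' u u' (fun k hk => h1 k (h hk)) (fun k hk => h2 k (h hk)) hs fun k hk => ?_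
    by_cases hk' : k ∈ S'
    · rw [← h1 k hk', ← h2 k hk', hs k hk]
    · exact h4 k hk'

open Classical in
-- A single intermediate configuration survives: `T` changes only sites in `S`, while `T'` fixes all
-- of those sites.
theorem entry_mul_of_disjoint {S S' : Set ℤ} (h : Disjoint S S') {T T' : Op d} (hT : ActsOn S T)
    (hT' : ActsOn S' T') (s s' : Conf d) :
    entry (T * T') s s' =
      entry T s (fun k => if k ∈ S then s' k else s k) *
        entry T' (fun k => if k ∈ S then s' k else s k) s' := by
  refine (hasSum_entry_mul T T' s s').unique ?_
  refine hasSum_single _ fun u hu => ?_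
  by_contra hne
  refine hu (funext fun k => ?_)
  split_ifs with hk
  · by_contra hk'
    exact hne (mul_eq_zero_of_right _ (hT'.1 _ _ ⟨k, Set.disjoint_left.1 h hk, hk'⟩))
  · by_contra hk'
    exact hne (mul_eq_zero_of_left (hT.1 _ _ ⟨k, hk, Ne.symm hk'⟩) _)

/-- Operators which act on disjoint sets of sites commute. -/
theorem ActsOn.commute {S S' : Set ℤ} (h : Disjoint S S') {T T' : Op d} (hT : ActsOn S T)
    (hT' : ActsOn S' T') : T * T' = T' * T := by
  classical
  refine op_ext fun s s' => ?_
  rw [entry_mul_of_disjoint h hT hT', entry_mul_of_disjoint h.symm hT' hT]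
  by_cases hs : ∃ k, k ∉ S ∧ k ∉ S' ∧ s k ≠ s' k
  · obtain ⟨k, hk, hk', hne⟩ := hs
    rw [hT'.1 _ s' ⟨k, hk', by simpa [hk] using hne⟩, hT.1 _ s' ⟨k, hk, by simpa [hk'] using hne⟩]
    simp
  · push Not at hs
    rw [mul_comm]
    congr 1
    · refine hT'.2 _ _ _ _ (fun k hk => ?_) (fun k hk => ?_) (fun k hk => ?_) (fun k hk => ?_)
      · simp [Set.disjoint_right.1 h hk]
      · simp [hk]
      · by_cases hk2 : k ∈ S <;> simp [hk2]
        exact hs k hk2 hk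
      · simp [hk]
    · refine hT.2 _ _ _ _ (fun k hk => ?_) (fun k hk => ?_) (fun k hk => ?_) (fun k hk => ?_)
      · simp [Set.disjoint_left.1 h hk]
      · simp [hk]
      · simp [hk]
      · by_cases hk2 : k ∈ S' <;> simp [hk2]
        exact hs k hk hk2

/-- If the partial trace of `T` over `k` vanishes and `T'` does not act on `k`, then the partial
trace of `T T'` over `k` vanishes. -/
theorem TracelessAt.mul {k : ℤ} {S : Set ℤ} (hk : k ∉ S) {T T' : Op d} (hT : TracelessAt k T)
    (hT' : ActsOn S T') : TracelessAt k (T * T') := by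
  intro s s'
  -- Since `T'` does not act on `k`, only intermediate configurations with value `a` at `k`
  -- contribute. Swapping `a` with `s' k` relabels them by the configurations with `u k = s' k`,
  -- independently of `a`; the sum over `a` can then be taken inside.
  let e : Fin (d k) → Conf d ≃ Conf d := fun a =>
    Equiv.piCongrRight fun j => if h : j = k then Equiv.swap (h ▸ a) (s' j) else Equiv.refl _
  have hek : ∀ a u, e a u k = Equiv.swap a (s' k) (u k) := fun a u => by simp [e]
  have hej : ∀ a u j, j ≠ k → e a u j = u j := fun a u j hj => by simp [e, hj]
  have hsum : ∀ a, HasSum (fun u => if u k = s' k then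
      entry T (Function.update s k a) (Function.update u k a) * entry T' u s' else 0)
      (entry (T * T') (Function.update s k a) (Function.update s' k a)) := by
    intro a
    have h := (e a).hasSum_iff.2
      (hasSum_entry_mul T T' (Function.update s k a) (Function.update s' k a))
    convert h using 2 with u
    simp only [Function.comp]
    split_ifs with hu
    · have heu : e a u = Function.update u k a := by
        funext j
        by_cases hj : j = k
        · subst hj; rw [hek, hu, Equiv.swap_apply_right, Function.update_self]
        · rw [hej a u j hj, Function.update_of_ne hj]
      rw [heu]
      congr 1
      by_cases hd : ∃ j, j ∉ S ∧ j ≠ k ∧ u j ≠ s' j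
      · obtain ⟨j, hj, hjk, hne⟩ := hd
        rw [hT'.1 u s' ⟨j, hj, hne⟩, hT'.1 _ _ ⟨j, hj, by
          rwa [Function.update_of_ne hjk, Function.update_of_ne hjk]⟩]
      · push Not at hd
        have hne : ∀ j ∈ S, j ≠ k := fun j hj hjk => hk (hjk ▸ hj)
        refine hT'.2 _ _ _ _ (fun j hj => ?_) (fun j hj => ?_) (fun j hj => ?_) (fun j hj => ?_)
        · rw [Function.update_of_ne (hne j hj)]
        · rw [Function.update_of_ne (hne j hj)]
        · by_cases hjk : j = k
          · subst hjk; exact hu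
          · exact hd j hj hjk
        · by_cases hjk : j = k
          · subst hjk; simp
          · rw [Function.update_of_ne hjk, Function.update_of_ne hjk]; exact hd j hj hjk
    · rw [hT'.1 _ _ ⟨k, hk, ?_⟩, mul_zero]
      rw [hek, Function.update_self]
      intro h
      apply hu
      have := congrArg (Equiv.swap a (s' k)) h
      simpa using this
  have htot := hasSum_sum fun a (_ : a ∈ (Finset.univ : Finset (Fin (d k)))) => hsum a
  refine htot.unique ?_
  convert hasSum_zero using 2 with u
  split_ifs with hu
  · rw [← Finset.sum_mul, hT, zero_mul]
  · simp

end Entries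

/-! ### The normalized trace -/

section Trace

variable {d : ℤ → ℕ} [∀ i, NeZero (d i)]

theorem normTrace_add (Λ : Finset ℤ) (T T' : Op d) :
    normTrace Λ (T + T') = normTrace Λ T + normTrace Λ T' := by
  simp only [normTrace, entry_add, Finset.sum_add_distrib, add_div]

theorem normTrace_sum {β : Type*} (Λ : Finset ℤ) (s : Finset β) (T : β → Op d) :
    normTrace Λ (∑ b ∈ s, T b) = ∑ b ∈ s, normTrace Λ (T b) := by
  classical
  induction s using Finset.induction_on with
  | empty => simp [normTrace, entry_zero]
  | insert a s ha ih => rw [Finset.sum_insert ha, Finset.sum_insert ha, normTrace_add, ih]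

/-- The trace over `Λ` can be taken at the site `k` before the others. -/
theorem normTrace_eq_zero {Λ : Finset ℤ} {k : ℤ} (hk : k ∈ Λ) {T : Op d} (hT : TracelessAt k T) :
    normTrace Λ T = 0 := by
  rw [normTrace, div_eq_zero_iff]
  left
  let k' : Λ := ⟨k, hk⟩
  rw [← (Equiv.piSplitAt k' (fun i : Λ => Fin (d i))).symm.sum_comp, Fintype.sum_prod_type,
    Finset.sum_comm]
  refine Finset.sum_eq_zero fun w _ => ?_
  have hcong : ∀ a : Fin (d k), extend Λ ((Equiv.piSplitAt k' (fun i : Λ => Fin (d i))).symm (a, w)) =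
      Function.update (extend Λ ((Equiv.piSplitAt k' (fun i : Λ => Fin (d i))).symm (0, w))) k a := by
    intro a
    funext j
    by_cases hj : j = k
    · subst hj
      simp [extend, hk, Equiv.piSplitAt, k']
    · rw [Function.update_of_ne hj]
      simp only [extend]
      split_ifs with hjΛ
      · have : (⟨j, hjΛ⟩ : Λ) ≠ k' := fun h => hj (congrArg Subtype.val h)
        simp [Equiv.piSplitAt, this]
      · rfl
  rw [← hT (extend Λ ((Equiv.piSplitAt k' (fun i : Λ => Fin (d i))).symm (0, w)))
    (extend Λ ((Equiv.piSplitAt k' (fun i : Λ => Fin (d i))).symm (0, w)))]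
  exact Finset.sum_congr rfl fun a _ => by rw [hcong a]

theorem norm_normTrace_le (Λ : Finset ℤ) (T : Op d) : ‖normTrace Λ T‖ ≤ ‖T‖ := by
  have hcard : (Fintype.card (∀ i : Λ, Fin (d i)) : ℝ) = ‖∏ i ∈ Λ, (d i : ℂ)‖ := by
    rw [Fintype.card_pi, norm_prod]
    simp only [Fintype.card_fin, Complex.norm_natCast, Nat.cast_prod]
    exact Finset.prod_coe_sort Λ fun i => (d i : ℝ)
  have hpos : 0 < ‖∏ i ∈ Λ, (d i : ℂ)‖ := by
    rw [norm_pos_iff, Finset.prod_ne_zero_iff]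
    exact fun i _ => Nat.cast_ne_zero.2 (NeZero.ne _)
  rw [normTrace, norm_div, div_le_iff₀ hpos, ← hcard]
  refine (norm_sum_le_of_le _ fun u _ => norm_entry_le T _ _).trans_eq ?_
  rw [Finset.sum_const, nsmul_eq_mul, mul_comm]; rfl

end Trace

/-! ### Dyadic windows and blocks -/

section Windows

theorem position_mono (a : ℤ) (R : ℕ) : Monotone (position a R) := fun x y h => by
  unfold position; omega

theorem one_le_position (a : ℤ) (R : ℕ) (x : ℤ) : 1 ≤ position a R x := le_max_left _ _

theorem position_le {R : ℕ} (hR : 1 ≤ R) (a x : ℤ) : position a R x ≤ R := by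
  unfold position; omega

theorem InBlock.scale_eq {R q k q' k' : ℕ} {m n : ℤ} (hq : 1 ≤ q) (hq' : 1 ≤ q')
    (h : InBlock R q k m n) (h' : InBlock R q' k' m n) : q = q' := by
  rcases lt_trichotomy q q' with hlt | heq | hlt
  · exact absurd h.2.2.1 (h'.2.2.2 q k hq hlt)
  · exact heq
  · exact absurd h'.2.2.1 (h.2.2.2 q' k' hq' hlt)

/-- A pair in two windows of scale `q` lies in `(2^(q-1) (k+1), 2^(q-1) (k+2)]`. This is the window
`2(k+1)` of scale `q - 1`, which a block excludes; for `q = 1` it has only one site. -/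
theorem InBlock.not_index_lt {R q k k' : ℕ} {m n : ℤ} (hq : 1 ≤ q)
    (h : InBlock R q k m n) (h' : InBlock R q k' m n) : ¬ k < k' := by
  intro hlt
  obtain ⟨-, -, ⟨-, h2, h3⟩, h4⟩ := h
  obtain ⟨-, -, ⟨h1, -, -⟩, -⟩ := h'
  have hpos : (0 : ℤ) < 2 ^ (q - 1) := by positivity
  have hk : (k : ℤ) + 1 ≤ k' := by exact_mod_cast hlt
  have h5 : 2 ^ (q - 1) * ((k : ℤ) + 1) < m :=
    (mul_le_mul_of_nonneg_left hk hpos.le).trans_lt h1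
  rcases Nat.lt_or_ge 1 q with hq1 | hq1
  · refine h4 (q - 1) (2 * (k + 1)) (by omega) (by omega) ⟨?_, h2, ?_⟩
    · have : (2 : ℤ) ^ (q - 1) = 2 ^ (q - 1 - 1) * 2 := by
        rw [← pow_succ]; congr 1; omega
      rw [this] at h5
      push_cast
      linarith
    · have : (2 : ℤ) ^ (q - 1) = 2 ^ (q - 1 - 1) * 2 := by
        rw [← pow_succ]; congr 1; omega
      rw [this] at h3
      push_cast
      linarith
  · have : q = 1 := by omega
    subst this
    simp at h3 h5
    omega

theorem InBlock.index_eq {R q k k' : ℕ} {m n : ℤ} (hq : 1 ≤ q)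
    (h : InBlock R q k m n) (h' : InBlock R q k' m n) : k = k' :=
  le_antisymm (not_lt.1 (h'.not_index_lt hq h)) (not_lt.1 (h.not_index_lt hq h'))

/-- The scale is the least one with a window containing the pair; it is at most `N` because the
window `0` of scale `N` is the whole segment. The index `q` starts at zero and stands for the scale
`q + 1`. -/
theorem exists_inBlock {N : ℕ} (hN : 1 ≤ N) {m n : ℤ} (hm : 1 ≤ m) (hmn : m < n)
    (hn : n ≤ 2 ^ N) :
    ∃ q k : ℕ, q < N ∧ k < 2 ^ (N - q) ∧ InBlock (2 ^ N) (q + 1) k m n := by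
  classical
  have hex : ∃ q, ∃ k : ℕ, InWindow (q + 1) k m n := by
    refine ⟨N - 1, 0, by simp; omega, hmn, ?_⟩
    have : (2 : ℤ) ^ N = 2 ^ (N - 1) * 2 := by rw [← pow_succ]; congr 1; omega
    simp only [Nat.add_sub_cancel, Nat.cast_zero, zero_add]
    omega
  have hqN : Nat.find hex ≤ N - 1 := by
    refine Nat.find_min' hex ⟨0, by simp; omega, hmn, ?_⟩
    have : (2 : ℤ) ^ N = 2 ^ (N - 1) * 2 := by rw [← pow_succ]; congr 1; omega
    simp only [Nat.add_sub_cancel, Nat.cast_zero, zero_add]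
    omega
  obtain ⟨k, hk⟩ := Nat.find_spec hex
  refine ⟨Nat.find hex, k, by omega, ?_, hm, by exact_mod_cast hn, hk, ?_⟩
  · have h1 := hk.1
    rw [Nat.add_sub_cancel] at h1
    have h2 : (2 : ℤ) ^ N = 2 ^ Nat.find hex * 2 ^ (N - Nat.find hex) := by
      rw [← pow_add]; congr 1; omega
    have h3 : (2 : ℤ) ^ Nat.find hex * k < 2 ^ Nat.find hex * 2 ^ (N - Nat.find hex) := by
      rw [← h2]; omega
    have h4 := lt_of_mul_lt_mul_left h3 (by positivity)
    exact_mod_cast h4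
  · intro q' k' h1 h2 hw
    refine Nat.find_min hex (m := q' - 1) (by omega) ⟨k', ?_⟩
    rwa [Nat.sub_add_cancel h1]

/-- The pairs in a block of scale `q` are at a distance of order `2^q`. -/
theorem InBlock.two_pow_le {R q k : ℕ} {m n : ℤ} (hq : 1 ≤ q) (h : InBlock R q k m n) :
    (2 : ℤ) ^ q ≤ 4 * (n - m) := by
  obtain ⟨hm, -, ⟨-, h2, -⟩, h4⟩ := h
  rcases Nat.lt_or_ge 1 q with hq1 | hq1
  · by_contra! hlt
    have e1 : (2 : ℤ) ^ q = 2 ^ (q - 1 - 1) * 4 := by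
      rw [show (4 : ℤ) = 2 ^ 2 by norm_num, ← pow_add]; congr 1; omega
    have hpos : (0 : ℤ) < 2 ^ (q - 1 - 1) := by positivity
    -- If `n - m < w`, the window of scale `q - 1` with index `⌊(m - 1) / w⌋` already contains the
    -- pair.
    set w : ℤ := 2 ^ (q - 1 - 1) with hw
    have hk0 : 0 ≤ (m - 1) / w := Int.ediv_nonneg (by omega) hpos.le
    refine h4 (q - 1) ((m - 1) / w).toNat (by omega) (by omega) ⟨?_, h2, ?_⟩
    · rw [Int.toNat_of_nonneg hk0, ← hw]
      have := Int.mul_ediv_self_le (x := m - 1) (k := w) hpos.ne'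
      omega
    · rw [Int.toNat_of_nonneg hk0, ← hw]
      have := Int.lt_mul_ediv_self_add (x := m - 1) (k := w) hpos
      have e2 : w * ((m - 1) / w + 2) = w * ((m - 1) / w) + 2 * w := by ring
      omega
  · have : q = 1 := by omega
    subst this
    omega

end Windows

/-! ### Block decomposition of the Hamiltonian and the commutator bound -/

namespace Hamiltonian

variable {d : ℤ → ℕ} (H : Hamiltonian d)

open Classical in
/-- The terms of the Hamiltonian inside `Λ` which do not connect different positions. -/
noncomputable def internal (Λ : Finset ℤ) (a : ℤ) (R : ℕ) : Op d :=
  ∑ i ∈ Λ, H.site i +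
    ∑ p ∈ Λ ×ˢ Λ with p.1 < p.2 ∧ position a R p.1 = position a R p.2, H.pair p.1 p.2

theorem internal_add_sum_block (Λ : Finset ℤ) (a : ℤ) {N : ℕ} (hN : 1 ≤ N) :
    H.internal Λ a (2 ^ N) + ∑ b : (Σ q : Fin N, Fin (2 ^ (N - (q : ℕ)))),
      H.block Λ a (2 ^ N) (b.1 + 1) b.2 = H.restrict Λ := by
  classical
  unfold internal block restrict
  rw [add_assoc]
  congr 1
  simp only [Finset.sum_filter]
  rw [Finset.sum_comm, ← Finset.sum_add_distrib]
  refine Finset.sum_congr rfl fun p _ => ?_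
  by_cases hp : p.1 < p.2
  · simp only [hp, true_and, if_true]
    rcases (position_mono a (2 ^ N) hp.le).eq_or_lt with heq | hlt
    · rw [if_pos heq, Finset.sum_eq_zero, add_zero]
      intro b _
      rw [if_neg]
      rintro ⟨-, -, hw, -⟩
      have := hw.2.1
      omega
    · rw [if_neg hlt.ne, zero_add]
      obtain ⟨q, k, hq, hk, hb⟩ := exists_inBlock hN (one_le_position a (2 ^ N) p.1) hlt
        (by exact_mod_cast position_le Nat.one_le_two_pow a p.2)
      rw [Finset.sum_eq_single (⟨⟨q, hq⟩, ⟨k, hk⟩⟩ : Σ q : Fin N, Fin (2 ^ (N - (q : ℕ)))),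
        if_pos hb]
      · rintro ⟨⟨q', hq'⟩, ⟨k', hk'⟩⟩ _ hne
        rw [if_neg]
        intro hb'
        apply hne
        have e1 := hb.scale_eq (by omega) (by omega) hb'
        have e1 : q = q' := by simpa using e1
        subst e1
        have e2 := hb.index_eq (by omega) hb'
        subst e2
        rfl
      · simp
  · simp [hp]

/-- The operators to the right of the position `f`. -/
def farRight (d : ℤ → ℕ) (a : ℤ) (R f : ℕ) : Set (Op d) :=
  {T | ActsOn {x | (f : ℤ) < position a R x} T}

theorem mem_centralizer_farRight {a : ℤ} {R f : ℕ} {S : Set ℤ} {T : Op d} (hT : ActsOn S T)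
    (hS : ∀ x ∈ S, position a R x ≤ f) : T ∈ (farRight d a R f).centralizer := by
  intro T' hT'
  refine ActsOn.commute ?_ hT' hT
  rw [Set.disjoint_left]
  intro x hx hx'
  exact absurd (hS x hx') (not_le.2 hx)

theorem mem_farRight {a : ℤ} {R f : ℕ} {S : Set ℤ} {T : Op d} (hT : ActsOn S T)
    (hS : ∀ x ∈ S, (f : ℤ) < position a R x) : T ∈ farRight d a R f :=
  hT.mono hS

/-- A term sitting at one position is either behind `f` or commutes with `x`. Hence one-site terms,
and all couplings among identified sites, never move the front and need no norm bound. -/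
theorem adI_mem_of_same_position {a : ℤ} {R f : ℕ} {S : Set ℤ} {T : Op d} (hT : ActsOn S T)
    {y : ℤ} (hS : ∀ x ∈ S, position a R x = y) {x : Op d}
    (hx : x ∈ (farRight d a R f).centralizer) : adI T x ∈ (farRight d a R f).centralizer := by
  rcases le_or_gt y f with h | h
  · exact adI_mem_centralizer (mem_centralizer_farRight hT fun x hx => by rw [hS x hx]; exact h) hx
  · have hc : T * x = x * T := hx T (mem_farRight hT fun x hx => by rw [hS x hx]; exact h)
    rw [adI_apply, hc, sub_self, smul_zero]
    exact Set.zero_mem_centralizer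

theorem adI_internal_mem (Λ : Finset ℤ) (a : ℤ) (R f : ℕ) {x : Op d}
    (hx : x ∈ (farRight d a R f).centralizer) :
    adI (H.internal Λ a R) x ∈ (farRight d a R f).centralizer := by
  rw [internal, adI_add, adI_sum, adI_sum, add_apply, sum_apply, sum_apply,
    ← Subalgebra.coe_centralizer ℂ]
  refine Subalgebra.add_mem _ (Subalgebra.sum_mem _ fun i _ => ?_)
    (Subalgebra.sum_mem _ fun p hp => ?_)
  · exact adI_mem_of_same_position (H.site_actsOn i) (y := position a R i) (by simp) hx
  · obtain ⟨-, h1, h2⟩ := Finset.mem_filter.1 hp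
    exact adI_mem_of_same_position (H.pair_actsOn _ _ h1) (y := position a R p.1)
      (by simp [h2]) hx

theorem block_mem_centralizer (Λ : Finset ℤ) (a : ℤ) (R q k f : ℕ) (hf : 2 ^ (q - 1) * (k + 2) ≤ f) :
    H.block Λ a R q k ∈ (farRight d a R f).centralizer := by
  classical
  rw [block, ← Subalgebra.coe_centralizer ℂ]
  refine Subalgebra.sum_mem _ fun p hp => ?_
  obtain ⟨-, h1, -, -, ⟨-, h2, h3⟩, -⟩ := Finset.mem_filter.1 hp
  refine mem_centralizer_farRight (H.pair_actsOn _ _ h1) ?_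
  have : (2 : ℤ) ^ (q - 1) * (k + 2) ≤ f := by exact_mod_cast hf
  intro x hx
  rcases hx with rfl | rfl <;> omega

theorem block_commute (Λ : Finset ℤ) (a : ℤ) (R q k f : ℕ) (hf : f ≤ 2 ^ (q - 1) * k) {x : Op d}
    (hx : x ∈ (farRight d a R f).centralizer) :
    H.block Λ a R q k * x = x * H.block Λ a R q k := by
  classical
  rw [block, Finset.sum_mul, Finset.mul_sum]
  refine Finset.sum_congr rfl fun p hp => ?_
  obtain ⟨-, h1, -, -, ⟨h2, h3, -⟩, -⟩ := Finset.mem_filter.1 hp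
  refine hx _ (mem_farRight (H.pair_actsOn _ _ h1) ?_)
  have : (f : ℤ) ≤ (2 : ℤ) ^ (q - 1) * k := by exact_mod_cast hf
  intro x hx
  rcases hx with rfl | rfl <;> omega

theorem isSelfAdjoint_block (Λ : Finset ℤ) (a : ℤ) (R q k : ℕ) :
    IsSelfAdjoint (H.block Λ a R q k) := by
  classical
  exact isSelfAdjoint_sum _ fun _ hp => H.pair_selfAdjoint _ _ (Finset.mem_filter.1 hp).2.1

theorem isSelfAdjoint_internal (Λ : Finset ℤ) (a : ℤ) (R : ℕ) :
    IsSelfAdjoint (H.internal Λ a R) :=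
  (isSelfAdjoint_sum _ fun i _ => H.site_selfAdjoint i).add
    (isSelfAdjoint_sum _ fun _ hp => H.pair_selfAdjoint _ _ (Finset.mem_filter.1 hp).2.1)

/-- The block decomposition of the Hamiltonian inside `Λ`. -/
noncomputable def blockChain (Λ : Finset ℤ) (a : ℤ) (N : ℕ) :
    BlockChain (fun q : Fin N => 2 ^ (N - (q : ℕ))) (Op d) where
  far := farRight d a (2 ^ N)
  h₀ := H.internal Λ a (2 ^ N)
  hb := fun b => H.block Λ a (2 ^ N) (b.1 + 1) b.2
  len := fun q => 2 ^ ((q : ℕ) + 1)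
  left := fun q k => 2 ^ (q : ℕ) * k
  right := fun q k => 2 ^ (q : ℕ) * (k + 2)
  selfAdjoint_h₀ := H.isSelfAdjoint_internal _ _ _
  selfAdjoint_hb := fun _ => H.isSelfAdjoint_block _ _ _ _ _
  far_antitone := fun f f' h T hT => ActsOn.mono (fun x (hx : (f' : ℤ) < _) =>
    lt_of_le_of_lt (by exact_mod_cast h) hx) hT
  adI_h₀_mem := fun f x hx => H.adI_internal_mem _ _ _ f hx
  hb_mem := fun q k => H.block_mem_centralizer _ _ _ _ _ _ (by simp)
  hb_commute := fun q k x hx => H.block_commute _ _ _ _ _ _ (by simp) hx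
  right_le := fun q k => le_of_eq (by ring)
  right_mono := fun q k k' h => Nat.mul_le_mul_left _ (Nat.add_le_add_right h 2)

/-- The Hamiltonian with all signs reversed. -/
noncomputable def reverse : Hamiltonian d where
  site := fun i => -H.site i
  pair := fun i j => -H.pair i j
  site_selfAdjoint := fun i => (H.site_selfAdjoint i).neg
  site_actsOn := fun i => ⟨fun s s' h => by
      have := (H.site_actsOn i).1 s s' h
      exact neg_eq_zero.2 this,
    fun s s' u u' h1 h2 h3 h4 => congrArg Neg.neg ((H.site_actsOn i).2 s s' u u' h1 h2 h3 h4)⟩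
  pair_selfAdjoint := fun i j h => (H.pair_selfAdjoint i j h).neg
  pair_actsOn := fun i j h => ⟨fun s s' hs => by
      have := (H.pair_actsOn i j h).1 s s' hs
      exact neg_eq_zero.2 this,
    fun s s' u u' h1 h2 h3 h4 => congrArg Neg.neg ((H.pair_actsOn i j h).2 s s' u u' h1 h2 h3 h4)⟩

theorem restrict_reverse (Λ : Finset ℤ) : H.reverse.restrict Λ = -H.restrict Λ := by
  simp only [restrict, reverse, Finset.sum_neg_distrib, neg_add]

theorem block_reverse (Λ : Finset ℤ) (a : ℤ) (R q k : ℕ) :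
    H.reverse.block Λ a R q k = -H.block Λ a R q k := by
  simp only [block, reverse, Finset.sum_neg_distrib]

theorem evolve_reverse (Λ : Finset ℤ) (t : ℝ) (A : Op d) :
    H.reverse.evolve Λ t A = H.evolve Λ (-t) A := by
  simp only [evolve, restrict_reverse, Complex.ofReal_neg, mul_neg, neg_smul, smul_neg]

theorem evolve_eq_expI (Λ : Finset ℤ) (t : ℝ) (A : Op d) :
    H.evolve Λ t A = expI (H.restrict Λ) t * A * expI (H.restrict Λ) (-t) := by
  simp only [evolve, expI, Complex.ofReal_neg, mul_neg, neg_smul]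

/-- If all blocks are small, then the commutator with an operator at the end of the segment is
small. -/
theorem norm_commutator_le_of_nonneg {Λ : Finset ℤ} {a : ℤ} {N : ℕ} (hN : 1 ≤ N) {b : Fin N → ℝ}
    (hb0 : ∀ q, 0 ≤ b q) (hb : ∀ (q : Fin N) (k : ℕ), ‖H.block Λ a (2 ^ N) (q + 1) k‖ ≤ b q)
    (cap : Fin N → ℕ) (hcap : ∑ q, (cap q - 1) * 2 ^ ((q : ℕ) + 1) + 1 < 2 ^ N)
    {A B : Op d} (hA : ActsOn (Set.Iic a) A)
    (hB : ActsOn (Set.Ici (a + 2 ^ N - 1)) B) {t : ℝ} (ht : 0 ≤ t) :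
    ‖H.evolve Λ t A * B - B * H.evolve Λ t A‖ ≤ 2 * (‖A‖ * ‖B‖) *
      (∏ q : Fin N, (1 + ((2 ^ (N - (q : ℕ))).choose (cap q) : ℝ) *
        orderedWeight (2 * b q) (cap q) t) - 1) := by
  have hAmem : A ∈ (farRight d a (2 ^ N) 1).centralizer :=
    mem_centralizer_farRight hA fun x hx => by
      have hx : x ≤ a := hx
      have : ((2 ^ N : ℕ) : ℤ) = 2 ^ N := by push_cast; rfl
      have h1 : (1 : ℤ) ≤ 2 ^ N := one_le_pow₀ (by norm_num)
      unfold position; push_cast; omega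
  obtain ⟨X, hX, hle⟩ := (H.blockChain Λ a N).exists_near_evolution cap (A := A) hAmem
    (a := fun q => 2 * b q) (fun q k => by
      have := hb q k
      change 2 * ‖H.block Λ a (2 ^ N) (q + 1) k‖ ≤ 2 * b q
      linarith) (fun q => by have := hb0 q; positivity) ht
  have hsum : (H.blockChain Λ a N).h₀ + ∑ b, (H.blockChain Λ a N).hb b = H.restrict Λ :=
    H.internal_add_sum_block Λ a hN
  rw [hsum, ← evolve_eq_expI] at hle
  -- All sites of `B` have the last position `2^N`, and `hcap` keeps the front strictly to its left.
  have hBX : B * X = X * B := by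
    refine hX B (mem_farRight hB fun x hx => ?_)
    have hx : a + 2 ^ N - 1 ≤ x := hx
    have h2 : (∑ q : Fin N, (cap q - 1) * 2 ^ ((q : ℕ) + 1) + 1 : ℕ) < ((2 ^ N : ℕ) : ℤ) := by
      exact_mod_cast hcap
    have h3 : position a (2 ^ N) x = ((2 ^ N : ℕ) : ℤ) := by
      have h1 : (1 : ℤ) ≤ 2 ^ N := one_le_pow₀ (by norm_num)
      unfold position; push_cast; omega
    rw [h3]
    change ((1 + ∑ q : Fin N, (cap q - 1) * 2 ^ ((q : ℕ) + 1) : ℕ) : ℤ) < _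
    rw [add_comm]; exact h2
  have heq : H.evolve Λ t A * B - B * H.evolve Λ t A =
      (H.evolve Λ t A - X) * B - B * (H.evolve Λ t A - X) := by
    rw [sub_mul, mul_sub, hBX]; abel
  rw [heq]
  have h1 := norm_mul_le (H.evolve Λ t A - X) B
  have h2 := norm_mul_le B (H.evolve Λ t A - X)
  have h3 := norm_sub_le ((H.evolve Λ t A - X) * B) (B * (H.evolve Λ t A - X))
  have h4 := mul_le_mul_of_nonneg_right hle (norm_nonneg B)
  linarith

/-- Negative times are positive times for the Hamiltonian with reversed signs. -/
theorem norm_commutator_le {Λ : Finset ℤ} {a : ℤ} {N : ℕ} (hN : 1 ≤ N) {b : Fin N → ℝ}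
    (hb0 : ∀ q, 0 ≤ b q) (hb : ∀ (q : Fin N) (k : ℕ), ‖H.block Λ a (2 ^ N) (q + 1) k‖ ≤ b q)
    (cap : Fin N → ℕ) (hcap : ∑ q, (cap q - 1) * 2 ^ ((q : ℕ) + 1) + 1 < 2 ^ N)
    {A B : Op d} (hA : ActsOn (Set.Iic a) A)
    (hB : ActsOn (Set.Ici (a + 2 ^ N - 1)) B) (t : ℝ) :
    ‖H.evolve Λ t A * B - B * H.evolve Λ t A‖ ≤ 2 * (‖A‖ * ‖B‖) *
      (∏ q : Fin N, (1 + ((2 ^ (N - (q : ℕ))).choose (cap q) : ℝ) *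
        orderedWeight (2 * b q) (cap q) |t|) - 1) := by
  rcases le_total 0 t with ht | ht
  · rw [abs_of_nonneg ht]
    exact H.norm_commutator_le_of_nonneg hN hb0 hb cap hcap hA hB ht
  · rw [abs_of_nonpos ht]
    have := H.reverse.norm_commutator_le_of_nonneg (Λ := Λ) hN hb0
      (fun q k => by rw [block_reverse, norm_neg]; exact hb q k) cap hcap hA hB
      (neg_nonneg.2 ht)
    rwa [evolve_reverse, neg_neg] at this

end Hamiltonian

/-! ### Counting pairs and bounding the norms of blocks -/

section PowerSums

/-- From `1 + y ≤ e^y` and `log((D+1)/D) ≥ 1/(D+1)`, the difference on the right is at least `s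
(D+1)^(-(s+1))`. Replacing `D + 1` by `D` costs `2^(s+1)`, as `D + 1 ≤ 2D`. -/
theorem rpow_neg_le_telescope {s : ℝ} (hs : 0 < s) {D : ℕ} (hD : 1 ≤ D) :
    (D : ℝ) ^ (-(s + 1)) ≤
      2 ^ (s + 1) / s * ((D : ℝ) ^ (-s) - ((D + 1 : ℕ) : ℝ) ^ (-s)) := by
  have hD0 : (1 : ℝ) ≤ D := by exact_mod_cast hD
  have hDp : (0 : ℝ) < D := by linarith
  have hE : (0 : ℝ) < (D : ℝ) + 1 := by linarith
  push_cast
  have hlog : 1 / ((D : ℝ) + 1) ≤ Real.log ((D + 1) / D) := by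
    have := Real.one_sub_inv_le_log_of_pos (x := ((D : ℝ) + 1) / D) (by positivity)
    refine le_trans (le_of_eq ?_) this
    field_simp
    ring
  have hratio : 1 + s / ((D : ℝ) + 1) ≤ (D : ℝ) ^ (-s) * ((D : ℝ) + 1) ^ s := by
    have h1 : (D : ℝ) ^ (-s) * ((D : ℝ) + 1) ^ s = Real.exp (s * Real.log ((D + 1) / D)) := by
      rw [Real.rpow_neg hDp.le, mul_comm, ← div_eq_mul_inv, ← Real.div_rpow hE.le hDp.le,
        Real.rpow_def_of_pos (by positivity), mul_comm]
    rw [h1]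
    have h2 := Real.add_one_le_exp (s * Real.log (((D : ℝ) + 1) / D))
    have h3 := mul_le_mul_of_nonneg_left hlog hs.le
    rw [mul_one_div] at h3
    linarith
  have hdiff : s * ((D : ℝ) + 1) ^ (-(s + 1)) ≤ (D : ℝ) ^ (-s) - ((D : ℝ) + 1) ^ (-s) := by
    have hp : 0 < ((D : ℝ) + 1) ^ (-s) := Real.rpow_pos_of_pos hE _
    have h1 := mul_le_mul_of_nonneg_right hratio hp.le
    rw [mul_assoc, ← Real.rpow_add hE, add_neg_cancel, Real.rpow_zero, mul_one] at h1
    have h2 : ((D : ℝ) + 1) ^ (-(s + 1)) = ((D : ℝ) + 1) ^ (-s) / (D + 1) := by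
      rw [neg_add, ← sub_eq_add_neg, Real.rpow_sub_one hE.ne']
    rw [h2]
    have : (1 + s / ((D : ℝ) + 1)) * (D + 1) ^ (-s) =
        (D + 1) ^ (-s) + s * ((D + 1) ^ (-s) / (D + 1)) := by ring
    linarith
  have hdouble : (D : ℝ) ^ (-(s + 1)) ≤ 2 ^ (s + 1) * ((D : ℝ) + 1) ^ (-(s + 1)) := by
    have h1 : (2 * (D : ℝ)) ^ (-(s + 1)) ≤ ((D : ℝ) + 1) ^ (-(s + 1)) :=
      Real.rpow_le_rpow_of_nonpos hE (by linarith) (by linarith)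
    rw [Real.mul_rpow (by norm_num) hDp.le, Real.rpow_neg (by norm_num : (0 : ℝ) ≤ 2)] at h1
    have h2 : (0 : ℝ) < 2 ^ (s + 1) := by positivity
    have h3 := mul_le_mul_of_nonneg_left h1 h2.le
    rwa [← mul_assoc, mul_inv_cancel₀ h2.ne', one_mul] at h3
  refine hdouble.trans ?_
  have h2 : (0 : ℝ) < 2 ^ (s + 1) := by positivity
  calc 2 ^ (s + 1) * ((D : ℝ) + 1) ^ (-(s + 1))
      = 2 ^ (s + 1) / s * (s * ((D : ℝ) + 1) ^ (-(s + 1))) := by field_simp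
    _ ≤ _ := mul_le_mul_of_nonneg_left hdiff (by positivity)

theorem sum_Ico_rpow_neg_le {s : ℝ} (hs : 0 < s) {m n : ℕ} (hm : 1 ≤ m) :
    ∑ D ∈ Finset.Ico m n, (D : ℝ) ^ (-(s + 1)) ≤ 2 ^ (s + 1) / s * (m : ℝ) ^ (-s) := by
  rcases le_or_gt m n with hmn | hmn
  · have hc : (0 : ℝ) ≤ 2 ^ (s + 1) / s := by positivity
    have hind : ∑ D ∈ Finset.Ico m n, (D : ℝ) ^ (-(s + 1)) ≤
        2 ^ (s + 1) / s * ((m : ℝ) ^ (-s) - (n : ℝ) ^ (-s)) := by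
      induction n, hmn using Nat.le_induction with
      | base => simp
      | succ n hmn ih =>
        rw [Finset.sum_Ico_succ_top hmn]
        have := rpow_neg_le_telescope hs (hm.trans hmn)
        nlinarith
    refine hind.trans (mul_le_mul_of_nonneg_left ?_ hc)
    have : 0 ≤ (n : ℝ) ^ (-s) := by positivity
    linarith
  · rw [Finset.Ico_eq_empty_of_le hmn.le, Finset.sum_empty]; positivity

end PowerSums

open Classical in
/-- The pairs of sites in `Λ` which belong to a block. -/
noncomputable def blockPairs (Λ : Finset ℤ) (a : ℤ) (R q k : ℕ) : Finset (ℤ × ℤ) :=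
  {p ∈ Λ ×ˢ Λ | p.1 < p.2 ∧ InBlock R q k (position a R p.1) (position a R p.2)}

theorem mem_blockPairs {Λ : Finset ℤ} {a : ℤ} {R q k : ℕ} {p : ℤ × ℤ} :
    p ∈ blockPairs Λ a R q k ↔ (p.1 ∈ Λ ∧ p.2 ∈ Λ) ∧ p.1 < p.2 ∧
      InBlock R q k (position a R p.1) (position a R p.2) := by
  simp [blockPairs]

theorem two_pow_le_of_mem_blockPairs {Λ : Finset ℤ} {a : ℤ} {R q k : ℕ} (hq : 1 ≤ q) {p : ℤ × ℤ}
    (hp : p ∈ blockPairs Λ a R q k) : (2 : ℤ) ^ q ≤ 4 * (p.2 - p.1) := by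
  obtain ⟨-, hlt, hb⟩ := mem_blockPairs.1 hp
  have h1 := hb.two_pow_le hq
  have : position a R p.2 - position a R p.1 ≤ p.2 - p.1 := by
    unfold position; omega
  omega

/-- At fixed distance `D` a pair is determined by its left site, which ranges over at most `2^q + D`
values even when the block contains sites outside the segment. Moreover `2^q ≤ 4D` if there is any
such pair. -/
theorem card_blockPairs_distance_le {Λ : Finset ℤ} {a : ℤ} {R q k : ℕ} (hq : 1 ≤ q) (D : ℕ) :
    ((blockPairs Λ a R q k).filter fun p => (p.2 - p.1).toNat = D).card ≤ 5 * D := by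
  set P := (blockPairs Λ a R q k).filter fun p => (p.2 - p.1).toNat = D with hP
  rcases P.eq_empty_or_nonempty with he | ⟨p₀, hp₀⟩
  · simp [he]
  have hD4 : (2 : ℤ) ^ q ≤ 4 * D := by
    obtain ⟨h1, h2⟩ := Finset.mem_filter.1 hp₀
    have := two_pow_le_of_mem_blockPairs hq h1
    have h3 := (mem_blockPairs.1 h1).2.1
    omega
  have e1 : (2 : ℤ) ^ q = 2 ^ (q - 1) * 2 := by rw [← pow_succ]; congr 1; omega
  set l : ℤ := 2 ^ (q - 1) * k with hl
  have e2 : (2 : ℤ) ^ (q - 1) * ((k : ℤ) + 2) = l + 2 ^ q := by rw [hl, e1]; ring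
  have hinj : P.card ≤ (Finset.Icc (a + l + 1 - D) (a + (l + 2 ^ q) - 2)).card := by
    refine Finset.card_le_card_of_injOn Prod.fst (fun p hp => ?_) fun p hp p' hp' h => ?_
    · obtain ⟨h1, h2⟩ := Finset.mem_filter.1 hp
      obtain ⟨-, hlt, hm, hn, ⟨h3, h4, h5⟩, -⟩ := mem_blockPairs.1 h1
      rw [e2] at h5
      rw [← hl] at h3
      simp only [Finset.coe_Icc, Set.mem_Icc]
      unfold position at *
      omega
    · obtain ⟨h1, h2⟩ := Finset.mem_filter.1 hp
      obtain ⟨h1', h2'⟩ := Finset.mem_filter.1 hp'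
      have h3 := (mem_blockPairs.1 h1).2.1
      have h3' := (mem_blockPairs.1 h1').2.1
      refine Prod.ext h ?_
      omega
  refine hinj.trans ?_
  rw [Int.card_Icc]
  omega

/-- The sum of `|x - y|^(-γ)` over the pairs in a block of scale `q` is of order `2^(q (2 - γ))`. -/
theorem sum_blockPairs_le {γ : ℝ} (hγ : 2 < γ) (Λ : Finset ℤ) (a : ℤ) (R : ℕ) {q : ℕ} (k : ℕ)
    (hq : 1 ≤ q) :
    ∑ p ∈ blockPairs Λ a R q k, ((p.2 - p.1 : ℤ) : ℝ) ^ (-γ) ≤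
      5 * (2 ^ (γ - 1) / (γ - 2)) * (4⁻¹ : ℝ) ^ (2 - γ) * ((2 : ℝ) ^ q) ^ (2 - γ) := by
  set P := blockPairs Λ a R q k with hP
  set g : ℤ × ℤ → ℕ := fun p => (p.2 - p.1).toNat with hg
  -- `D₀ = ⌈2^q / 4⌉` bounds all distances in the block from below.
  set D₀ : ℕ := (2 ^ q + 3) / 4 with hD₀
  have hD₀1 : 1 ≤ D₀ := by
    have := Nat.one_le_two_pow (n := q)
    omega
  have hmaps : ∀ p ∈ P, g p ∈ Finset.Ico D₀ (P.sup g + 1) := by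
    intro p hp
    have h1 := two_pow_le_of_mem_blockPairs hq hp
    have h2 : g p ≤ P.sup g := Finset.le_sup hp
    have h3 : ((2 ^ q : ℕ) : ℤ) ≤ 4 * (p.2 - p.1) := by exact_mod_cast h1
    rw [Finset.mem_Ico]
    simp only [hg] at *
    omega
  have hcast : ∀ p ∈ P, ((p.2 - p.1 : ℤ) : ℝ) = (g p : ℝ) := by
    intro p hp
    have h := (mem_blockPairs.1 hp).2.1
    have : ((g p : ℕ) : ℤ) = p.2 - p.1 := Int.toNat_of_nonneg (by omega)
    rw [← this]; simp
  rw [Finset.sum_congr rfl fun p hp => by rw [hcast p hp],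
    ← Finset.sum_fiberwise_of_maps_to hmaps]
  have hfib : ∀ D ∈ Finset.Ico D₀ (P.sup g + 1),
      ∑ p ∈ P with g p = D, (g p : ℝ) ^ (-γ) ≤ 5 * (D : ℝ) ^ (-((γ - 2) + 1)) := by
    intro D hD
    have hDpos : (0 : ℝ) < D := by
      have := (Finset.mem_Ico.1 hD).1
      exact_mod_cast (show 0 < D by omega)
    rw [Finset.sum_congr rfl fun p hp => by rw [(Finset.mem_filter.1 hp).2], Finset.sum_const,
      nsmul_eq_mul]
    have hc : ((P.filter fun p => g p = D).card : ℝ) ≤ 5 * D := by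
      exact_mod_cast card_blockPairs_distance_le hq D
    calc _ ≤ 5 * (D : ℝ) * (D : ℝ) ^ (-γ) := mul_le_mul_of_nonneg_right hc (by positivity)
      _ = 5 * (D : ℝ) ^ (-((γ - 2) + 1)) := by
        rw [mul_assoc, ← Real.rpow_one_add' hDpos.le (by linarith)]
        congr 2; ring
  refine (Finset.sum_le_sum hfib).trans ?_
  rw [← Finset.mul_sum]
  have hs := sum_Ico_rpow_neg_le (s := γ - 2) (by linarith) (m := D₀) (n := P.sup g + 1) hD₀1
  have hD₀le : (4⁻¹ : ℝ) * 2 ^ q ≤ D₀ := by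
    have : 2 ^ q ≤ 4 * D₀ := by omega
    have : (2 : ℝ) ^ q ≤ 4 * D₀ := by exact_mod_cast this
    linarith
  have hpow : (D₀ : ℝ) ^ (-(γ - 2)) ≤ (4⁻¹ : ℝ) ^ (2 - γ) * ((2 : ℝ) ^ q) ^ (2 - γ) := by
    rw [← Real.mul_rpow (by norm_num) (by positivity), neg_sub]
    exact Real.rpow_le_rpow_of_nonpos (by positivity) hD₀le (by linarith)
  have e : γ - 2 + 1 = γ - 1 := by ring
  rw [e] at hs ⊢
  have hc : (0 : ℝ) ≤ 2 ^ (γ - 1) / (γ - 2) := div_nonneg (by positivity) (by linarith)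
  calc _ ≤ 5 * (2 ^ (γ - 1) / (γ - 2) * (D₀ : ℝ) ^ (-(γ - 2))) := by linarith
    _ ≤ 5 * (2 ^ (γ - 1) / (γ - 2) * ((4⁻¹ : ℝ) ^ (2 - γ) * ((2 : ℝ) ^ q) ^ (2 - γ))) := by
      gcongr
    _ = _ := by ring

namespace Hamiltonian

variable {d : ℤ → ℕ} {H : Hamiltonian d} {α h : ℝ}

theorem block_eq_sum (H : Hamiltonian d) (Λ : Finset ℤ) (a : ℤ) (R q k : ℕ) :
    H.block Λ a R q k = ∑ p ∈ blockPairs Λ a R q k, H.pair p.1 p.2 := rfl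

theorem PowerLaw.norm_pair_le (hH : H.PowerLaw α h) {i j : ℤ} (hij : i < j) :
    ‖H.pair i j‖ ≤ |h| * ((j - i : ℤ) : ℝ) ^ (-α) := by
  have hpos : (0 : ℝ) < ((j - i : ℤ) : ℝ) := by exact_mod_cast sub_pos.2 hij
  refine (hH i j hij).trans ?_
  rw [Real.rpow_neg hpos.le, div_eq_mul_inv]
  exact mul_le_mul_of_nonneg_right (le_abs_self h) (by positivity)

theorem PowerLaw.norm_block_le (hH : H.PowerLaw α h) (hα : 2 < α) (Λ : Finset ℤ) (a : ℤ) (R : ℕ)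
    {q : ℕ} (k : ℕ) (hq : 1 ≤ q) :
    ‖H.block Λ a R q k‖ ≤ |h| * (5 * (2 ^ (α - 1) / (α - 2)) * (4⁻¹ : ℝ) ^ (2 - α)) *
      ((2 : ℝ) ^ q) ^ (2 - α) := by
  rw [block_eq_sum]
  refine (norm_sum_le_of_le _ fun p hp => hH.norm_pair_le (mem_blockPairs.1 hp).2.1).trans ?_
  rw [← Finset.mul_sum, mul_assoc |h|]
  exact mul_le_mul_of_nonneg_left (sum_blockPairs_le hα Λ a R k hq) (abs_nonneg h)

variable [∀ i, NeZero (d i)]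

/-- Distinct couplings are orthogonal for the trace: one of the two sites of the first is not acted
on by the second, and the partial trace of the product over that site vanishes. -/
theorem norm2_block_sq_le
    (htr : ∀ i j : ℤ, i < j → TracelessAt i (H.pair i j) ∧ TracelessAt j (H.pair i j))
    (Λ : Finset ℤ) (a : ℤ) (R q k : ℕ) :
    (normTrace Λ (H.block Λ a R q k * H.block Λ a R q k)).re ≤
      ∑ p ∈ blockPairs Λ a R q k, ‖H.pair p.1 p.2‖ ^ 2 := by
  rw [block_eq_sum, Finset.sum_mul_sum, normTrace_sum]
  have hdiag : ∀ p ∈ blockPairs Λ a R q k,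
      normTrace Λ (∑ p' ∈ blockPairs Λ a R q k, H.pair p.1 p.2 * H.pair p'.1 p'.2) =
        normTrace Λ (H.pair p.1 p.2 * H.pair p.1 p.2) := by
    intro p hp
    rw [normTrace_sum]
    refine Finset.sum_eq_single_of_mem p hp fun p' hp' hne => ?_
    obtain ⟨⟨m1, m2⟩, hlt, -⟩ := mem_blockPairs.1 hp
    obtain ⟨-, hlt', -⟩ := mem_blockPairs.1 hp'
    obtain ⟨t1, t2⟩ := htr _ _ hlt
    by_cases h1 : p.1 ∈ ({p'.1, p'.2} : Set ℤ)
    · have h2 : p.2 ∉ ({p'.1, p'.2} : Set ℤ) := by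
        intro h2
        apply hne
        simp only [Set.mem_insert_iff, Set.mem_singleton_iff] at h1 h2
        refine Prod.ext ?_ ?_ <;> omega
      exact normTrace_eq_zero m2 (t2.mul h2 (H.pair_actsOn _ _ hlt'))
    · exact normTrace_eq_zero m1 (t1.mul h1 (H.pair_actsOn _ _ hlt'))
  rw [Finset.sum_congr rfl hdiag, Complex.re_sum]
  refine Finset.sum_le_sum fun p _ => ?_
  refine (Complex.re_le_norm _).trans ((norm_normTrace_le _ _).trans ?_)
  rw [sq]
  exact norm_mul_le _ _

/-- The squared couplings decay with exponent `2α`, so they sum to order `2^(q(2-2α))`; the square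
root improves the triangle inequality by the factor `2^(-q)`. -/
theorem PowerLaw.norm2_block_le (hH : H.PowerLaw α h) (hα : 1 < α)
    (htr : ∀ i j : ℤ, i < j → TracelessAt i (H.pair i j) ∧ TracelessAt j (H.pair i j))
    (Λ : Finset ℤ) (a : ℤ) (R : ℕ) {q : ℕ} (k : ℕ) (hq : 1 ≤ q) :
    norm2 Λ (H.block Λ a R q k) ≤
      |h| * √(5 * (2 ^ (2 * α - 1) / (2 * α - 2)) * (4⁻¹ : ℝ) ^ (2 - 2 * α)) *
        ((2 : ℝ) ^ q) ^ (1 - α) := by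
  rw [norm2]
  refine Real.sqrt_le_iff.2 ⟨by positivity, (norm2_block_sq_le htr Λ a R q k).trans ?_⟩
  have hc : (0 : ℝ) ≤ 5 * (2 ^ (2 * α - 1) / (2 * α - 2)) * (4⁻¹ : ℝ) ^ (2 - 2 * α) := by
    have : (0 : ℝ) ≤ 2 ^ (2 * α - 1) / (2 * α - 2) := div_nonneg (by positivity) (by linarith)
    positivity
  have h2q : (((2 : ℝ) ^ q) ^ (1 - α)) ^ 2 = ((2 : ℝ) ^ q) ^ (2 - 2 * α) := by
    rw [← Real.rpow_natCast, ← Real.rpow_mul (by positivity)]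
    congr 1; push_cast; ring
  rw [mul_pow, mul_pow, Real.sq_sqrt hc, h2q, mul_assoc]
  have hs := sum_blockPairs_le (γ := 2 * α) (by linarith) Λ a R k hq
  refine le_trans ?_ (mul_le_mul_of_nonneg_left hs (sq_nonneg |h|))
  rw [Finset.mul_sum]
  refine Finset.sum_le_sum fun p hp => ?_
  have hlt := (mem_blockPairs.1 hp).2.1
  have hpos : (0 : ℝ) < ((p.2 - p.1 : ℤ) : ℝ) := by exact_mod_cast sub_pos.2 hlt
  have h1 := pow_le_pow_left₀ (norm_nonneg _) (hH.norm_pair_le hlt) 2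
  refine h1.trans_eq ?_
  rw [mul_pow]
  congr 1
  rw [← Real.rpow_natCast, ← Real.rpow_mul hpos.le]
  congr 1; push_cast; ring

theorem PowerLaw.norm_block_le_of_frustrated (hH : H.PowerLaw α h) (hα : 1 < α) {κ : ℝ}
    (hκ : 0 < κ) (hf : H.FrustratedWith κ) (Λ : Finset ℤ) (a : ℤ) {n q : ℕ} (k : ℕ) (hn : 1 ≤ n)
    (hq : 1 ≤ q) :
    ‖H.block Λ a (2 ^ n) q k‖ ≤
      κ⁻¹ * (|h| * √(5 * (2 ^ (2 * α - 1) / (2 * α - 2)) * (4⁻¹ : ℝ) ^ (2 - 2 * α))) *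
        ((2 : ℝ) ^ q) ^ (1 - α) := by
  set c := |h| * √(5 * (2 ^ (2 * α - 1) / (2 * α - 2)) * (4⁻¹ : ℝ) ^ (2 - 2 * α)) *
        ((2 : ℝ) ^ q) ^ (1 - α) with hc
  have hc0 : 0 ≤ c := by positivity
  have h2 : H.blockNorm2 a (2 ^ n) q k ≤ ENNReal.ofReal c :=
    iSup_le fun Λ => ENNReal.ofReal_le_ofReal (hH.norm2_block_le hα hf.1 Λ a _ k hq)
  have h1 : ENNReal.ofReal (κ * ‖H.block Λ a (2 ^ n) q k‖) ≤ ENNReal.ofReal c := by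
    rw [ENNReal.ofReal_mul hκ.le]
    refine le_trans ?_ ((hf.2 a n q k hn hq).trans h2)
    gcongr
    exact le_iSup (fun Λ => ENNReal.ofReal ‖H.block Λ a (2 ^ n) q k‖) Λ
  rw [ENNReal.ofReal_le_ofReal_iff hc0] at h1
  rw [mul_assoc, ← hc]
  rw [inv_mul_eq_div, le_div_iff₀ hκ]
  linarith

end Hamiltonian

/-- The norm of a block of scale `q` is of order `2^(q (1 - α'))`, where `α'` is the effective
exponent. -/
theorem exists_norm_block_le (α h : ℝ) {κ : ℝ} (hκ : 0 < κ) :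
    ∃ C : ℝ, 0 < C ∧ ∀ (d : ℤ → ℕ) [∀ i, NeZero (d i)] (H : Hamiltonian d), H.PowerLaw α h →
      1 < H.effExponent κ α → ∀ (Λ : Finset ℤ) (a : ℤ) (n q k : ℕ), 1 ≤ n → 1 ≤ q →
        ‖H.block Λ a (2 ^ n) q k‖ ≤ C * ((2 : ℝ) ^ q) ^ (1 - H.effExponent κ α) := by
  set C₁ := |h| * (5 * (2 ^ (α - 1) / (α - 2)) * (4⁻¹ : ℝ) ^ (2 - α)) with hC₁
  set C₂ := κ⁻¹ * (|h| * √(5 * (2 ^ (2 * α - 1) / (2 * α - 2)) * (4⁻¹ : ℝ) ^ (2 - 2 * α))) with hC₂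
  -- `C₁` is meaningful only for `α > 2` and `C₂` only for `α > 1`; each is used only in its range,
  -- and the `1` secures positivity.
  refine ⟨max (max C₁ C₂) 1, by positivity, fun d _ H hH heff Λ a n q k hn hq => ?_⟩
  by_cases hf : H.FrustratedWith κ
  · rw [Hamiltonian.effExponent, if_pos hf] at heff ⊢
    refine (hH.norm_block_le_of_frustrated heff hκ hf Λ a k hn hq).trans ?_
    refine mul_le_mul_of_nonneg_right ?_ (by positivity)
    exact (le_max_right _ _).trans (le_max_left _ _)
  · rw [Hamiltonian.effExponent, if_neg hf] at heff ⊢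
    refine (hH.norm_block_le (by linarith) Λ a _ k hq).trans ?_
    rw [show 1 - (α - 1) = 2 - α by ring]
    refine mul_le_mul_of_nonneg_right ?_ (by positivity)
    exact (le_max_left _ _).trans (le_max_left _ _)

/-! ### Choosing the caps in the three regimes -/

section Weights

theorem inv_factorial_le (c : ℕ) : ((c.factorial : ℝ))⁻¹ ≤ (Real.exp 1 / c) ^ c := by
  rcases Nat.eq_zero_or_pos c with rfl | hc
  · simp
  have hc' : (0 : ℝ) < c := by exact_mod_cast hc
  have h := Real.pow_div_factorial_le_exp (c : ℝ) hc'.le c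
  have hf : (0 : ℝ) < c.factorial := by exact_mod_cast c.factorial_pos
  have he : Real.exp (c : ℝ) = Real.exp 1 ^ c := by rw [← Real.exp_nat_mul, mul_one]
  rw [div_pow, ← he, inv_eq_one_div, div_le_div_iff₀ hf (by positivity)]
  rw [div_le_iff₀ hf] at h
  linarith

/-- There is one factorial from ordering in space and one from ordering in time. Together they give
`c²` in the denominator, so the weight becomes small once `c` exceeds a multiple of `√(m a t)`. -/
theorem choose_mul_orderedWeight_le {a t : ℝ} (ha : 0 ≤ a) (ht : 0 ≤ t) (m c : ℕ) :
    (m.choose c : ℝ) * orderedWeight a c t ≤ (Real.exp 1 ^ 2 * (m * a * t) / (c : ℝ) ^ 2) ^ c := by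
  have h1 : (m.choose c : ℝ) ≤ (m : ℝ) ^ c / c.factorial := Nat.choose_le_pow_div c m
  have h2 := inv_factorial_le c
  have h3 : (0 : ℝ) ≤ ((c.factorial : ℝ))⁻¹ := by positivity
  unfold orderedWeight
  calc (m.choose c : ℝ) * ((a * t) ^ c / c.factorial)
      ≤ (m : ℝ) ^ c / c.factorial * ((a * t) ^ c / c.factorial) := by gcongr
    _ = (m * a * t) ^ c * (((c.factorial : ℝ))⁻¹ * ((c.factorial : ℝ))⁻¹) := by
      rw [mul_pow, mul_pow, mul_pow]; ring
    _ ≤ (m * a * t) ^ c * ((Real.exp 1 / c) ^ c * (Real.exp 1 / c) ^ c) := by gcongr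
    _ = _ := by rw [← mul_pow, ← mul_pow]; congr 1; ring

/-- The rate of the blocks of scale `q + 1`. -/
noncomputable def rate (C β : ℝ) (q : ℕ) : ℝ := 2 * (C * ((2 : ℝ) ^ (q + 1)) ^ (1 - β))

/-- There are caps on the numbers of records for which the front cannot cross the segment, and
which are exceeded with a total weight of at most `η`. -/
def Confined (C β η : ℝ) (N : ℕ) (t : ℝ) : Prop :=
  ∃ cap : Fin N → ℕ, ∑ q, (cap q - 1) * 2 ^ ((q : ℕ) + 1) + 1 < 2 ^ N ∧
    ∑ q : Fin N, ((2 ^ (N - (q : ℕ))).choose (cap q) : ℝ) * orderedWeight (rate C β q) (cap q) t ≤ η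

variable {C β : ℝ} {N : ℕ}

theorem two_pow_split (q : Fin N) : (2 : ℝ) ^ ((q : ℕ) + 1) * 2 ^ (N - 1 - (q : ℕ)) = 2 ^ N := by
  rw [← pow_add]; congr 1; have := q.2; omega

/-- The number `ρ q` is the fraction of the segment granted to a scale: `⌊ρ q 2^(N-1-q)⌋` blocks of
length `2^(q+1)` cover at most `ρ q 2^N` positions. -/
theorem sum_cap_lt (hN : 1 ≤ N) {ρ : Fin N → ℝ} (hρ : ∀ q, 0 < ρ q) (hsum : ∑ q, ρ q ≤ 1 / 4) :
    ∑ q : Fin N, (⌊ρ q * 2 ^ (N - 1 - (q : ℕ))⌋₊ + 1 - 1) * 2 ^ ((q : ℕ) + 1) + 1 < 2 ^ N := by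
  have h : ((∑ q : Fin N, (⌊ρ q * 2 ^ (N - 1 - (q : ℕ))⌋₊ + 1 - 1) * 2 ^ ((q : ℕ) + 1) + 1 : ℕ) : ℝ)
      < ((2 ^ N : ℕ) : ℝ) := by
    simp only [Nat.add_sub_cancel]
    push_cast
    have h1 : ∑ q : Fin N, ((⌊ρ q * 2 ^ (N - 1 - (q : ℕ))⌋₊ : ℕ) : ℝ) * 2 ^ ((q : ℕ) + 1) ≤
        ∑ q : Fin N, ρ q * 2 ^ N := by
      refine Finset.sum_le_sum fun q _ => ?_
      rw [← two_pow_split q, mul_comm ((2 : ℝ) ^ ((q : ℕ) + 1)), ← mul_assoc]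
      refine mul_le_mul_of_nonneg_right (Nat.floor_le ?_) (by positivity)
      have := hρ q; positivity
    rw [← Finset.sum_mul] at h1
    have h2 : (2 : ℝ) ≤ 2 ^ N := by
      calc (2 : ℝ) = 2 ^ 1 := by norm_num
        _ ≤ 2 ^ N := pow_le_pow_right₀ (by norm_num) hN
    have h3 := mul_le_mul_of_nonneg_right hsum (by positivity : (0 : ℝ) ≤ 2 ^ N)
    linarith
  exact_mod_cast h

theorem weight_le (hC : 0 < C) {t : ℝ} (ht : 0 ≤ t) (q : Fin N) {ρ : ℝ} (hρ : 0 < ρ)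
    {c : ℕ} (hc : 1 ≤ c) :
    ((2 ^ (N - (q : ℕ))).choose c : ℝ) * orderedWeight (rate C β q) c t ≤
      (4 * Real.exp 1 ^ 2 * C * (t * ((2 : ℝ) ^ ((q : ℕ) + 1)) ^ (2 - β) / 2 ^ N) / ρ ^ 2 *
        ((ρ * 2 ^ (N - 1 - (q : ℕ))) ^ 2 / (c : ℝ) ^ 2)) ^ c := by
  have hr : 0 ≤ rate C β q := by unfold rate; positivity
  refine (choose_mul_orderedWeight_le hr ht _ c).trans_eq ?_
  congr 1
  have hc' : (c : ℝ) ≠ 0 := by exact_mod_cast (by omega : c ≠ 0)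
  have hM : ((2 ^ (N - (q : ℕ)) : ℕ) : ℝ) = 2 * 2 ^ (N - 1 - (q : ℕ)) := by
    push_cast
    rw [← pow_succ']; congr 1; have := q.2; omega
  have hp : (0 : ℝ) < 2 ^ ((q : ℕ) + 1) := by positivity
  have hsplit : ((2 : ℝ) ^ ((q : ℕ) + 1)) ^ (2 - β) =
      2 ^ ((q : ℕ) + 1) * ((2 : ℝ) ^ ((q : ℕ) + 1)) ^ (1 - β) := by
    rw [show 2 - β = 1 + (1 - β) by ring, Real.rpow_add hp, Real.rpow_one]
  rw [hM, hsplit, rate, ← two_pow_split q]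
  field_simp
  ring

theorem sum_pow_le_of_injective {x : ℝ} (hx0 : 0 ≤ x) (hx1 : x < 1) {e : Fin N → ℕ}
    (he : Function.Injective e) : ∑ q, x ^ e q ≤ (1 - x)⁻¹ := by
  rw [← tsum_geometric_of_lt_one hx0 hx1]
  have h : ∑ q, x ^ e q = ∑ j ∈ Finset.univ.map ⟨e, he⟩, x ^ j := by simp
  rw [h]
  exact (summable_geometric_of_lt_one hx0 hx1).sum_le_tsum _ fun j _ => by positivity

/-- The regimes in which the scales contribute geometrically. -/
theorem confined_of_geometric (hC : 0 < C) {η x : ℝ} (hη : 0 < η) (hη1 : η ≤ 1) (hx0 : 0 < x)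
    (hx1 : x < 1) (hN : 1 ≤ N) {e : Fin N → ℕ} (he : Function.Injective e) {t : ℝ} (ht : 0 ≤ t)
    (hbound : ∀ q : Fin N, t * ((2 : ℝ) ^ ((q : ℕ) + 1)) ^ (2 - β) / 2 ^ N ≤
      η * (1 - x) ^ 3 / (64 * Real.exp 1 ^ 2 * C) * (x ^ 4) ^ e q) :
    Confined C β η N t := by
  have hx : 0 < 1 - x := by linarith
  -- The prefactor makes the fractions sum to at most `1/4`. Dividing the `x^(4e)` of `hbound` by
  -- `ρ²` leaves `x^(2e)`, still summable over the scales.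
  set ρ : Fin N → ℝ := fun q => (1 - x) / 4 * x ^ e q with hρdef
  have hρ : ∀ q, 0 < ρ q := fun q => by simp only [hρdef]; positivity
  have hρsum : ∑ q, ρ q ≤ 1 / 4 := by
    simp only [hρdef]
    rw [← Finset.mul_sum]
    have h1 := mul_le_mul_of_nonneg_left (sum_pow_le_of_injective hx0.le hx1 he)
      (by positivity : 0 ≤ (1 - x) / 4)
    refine h1.trans_eq ?_
    field_simp
  refine ⟨fun q => ⌊ρ q * 2 ^ (N - 1 - (q : ℕ))⌋₊ + 1, sum_cap_lt hN hρ hρsum, ?_⟩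
  have hterm : ∀ q : Fin N, ((2 ^ (N - (q : ℕ))).choose (⌊ρ q * 2 ^ (N - 1 - (q : ℕ))⌋₊ + 1) : ℝ) *
      orderedWeight (rate C β q) (⌊ρ q * 2 ^ (N - 1 - (q : ℕ))⌋₊ + 1) t ≤
        η * (1 - x) * x ^ e q := by
    intro q
    set c := ⌊ρ q * 2 ^ (N - 1 - (q : ℕ))⌋₊ + 1 with hc
    have hcu : ρ q * 2 ^ (N - 1 - (q : ℕ)) ≤ (c : ℝ) := by
      have := (Nat.lt_floor_add_one (ρ q * 2 ^ (N - 1 - (q : ℕ)))).le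
      rw [hc]; push_cast; exact this
    have hu : 0 ≤ ρ q * 2 ^ (N - 1 - (q : ℕ)) := by have := hρ q; positivity
    have hcpos : (0 : ℝ) < c := by rw [hc]; positivity
    have hfrac : (ρ q * 2 ^ (N - 1 - (q : ℕ))) ^ 2 / (c : ℝ) ^ 2 ≤ 1 := by
      rw [div_le_one (by positivity)]
      exact pow_le_pow_left₀ hu hcu 2
    have hxe : x ^ e q ≤ 1 := pow_le_one₀ hx0.le hx1.le
    have hxe0 : 0 < x ^ e q := by positivity
    have hbase : 4 * Real.exp 1 ^ 2 * C * (t * ((2 : ℝ) ^ ((q : ℕ) + 1)) ^ (2 - β) / 2 ^ N) /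
        ρ q ^ 2 ≤ η * (1 - x) * x ^ e q := by
      have h1 : 4 * Real.exp 1 ^ 2 * C * (t * ((2 : ℝ) ^ ((q : ℕ) + 1)) ^ (2 - β) / 2 ^ N) ≤
          4 * Real.exp 1 ^ 2 * C *
            (η * (1 - x) ^ 3 / (64 * Real.exp 1 ^ 2 * C) * (x ^ 4) ^ e q) :=
        mul_le_mul_of_nonneg_left (hbound q) (by positivity)
      rw [div_le_iff₀ (pow_pos (hρ q) 2)]
      refine h1.trans ?_
      have h2 : 4 * Real.exp 1 ^ 2 * C *
          (η * (1 - x) ^ 3 / (64 * Real.exp 1 ^ 2 * C) * (x ^ 4) ^ e q) =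
          η * (1 - x) ^ 3 / 16 * (x ^ e q) ^ 4 := by
        rw [← pow_mul x 4, mul_comm 4 (e q), pow_mul]
        field_simp
        ring
      rw [h2]
      simp only [hρdef]
      have h3 : (x ^ e q) ^ 4 ≤ (x ^ e q) ^ 3 := pow_le_pow_of_le_one hxe0.le hxe (by norm_num)
      have h4 : 0 ≤ η * (1 - x) ^ 3 / 16 := by positivity
      nlinarith [mul_le_mul_of_nonneg_left h3 h4]
    have hle1 : η * (1 - x) * x ^ e q ≤ 1 := by
      have : η * (1 - x) ≤ 1 := mul_le_one₀ hη1 hx.le (by linarith)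
      exact mul_le_one₀ this hxe0.le hxe
    have hb0 : 0 ≤ 4 * Real.exp 1 ^ 2 * C *
        (t * ((2 : ℝ) ^ ((q : ℕ) + 1)) ^ (2 - β) / 2 ^ N) / ρ q ^ 2 := by positivity
    refine (weight_le hC ht q (hρ q) (by omega)).trans ?_
    have hz : 4 * Real.exp 1 ^ 2 * C * (t * ((2 : ℝ) ^ ((q : ℕ) + 1)) ^ (2 - β) / 2 ^ N) /
        ρ q ^ 2 * ((ρ q * 2 ^ (N - 1 - (q : ℕ))) ^ 2 / (c : ℝ) ^ 2) ≤ η * (1 - x) * x ^ e q :=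
      (mul_le_of_le_one_right hb0 hfrac).trans hbase
    -- The cap is at least `1` and the base at most `1`, so the power is at most its base.
    refine (pow_le_of_le_one (by positivity) (hz.trans hle1) (by omega)).trans hz
  refine (Finset.sum_le_sum fun q _ => hterm q).trans ?_
  rw [← Finset.mul_sum]
  refine (mul_le_mul_of_nonneg_left (sum_pow_le_of_injective hx0.le hx1 he)
    (by positivity)).trans_eq ?_
  field_simp

/-- Here `2^((q+1)(2-β))` decays with the scale, so the fractions decrease geometrically from the
shortest scale upwards. -/
theorem exists_confined_of_two_lt (hC : 0 < C) (hβ : 2 < β) {η : ℝ} (hη : 0 < η) (hη1 : η ≤ 1) :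
    ∃ K : ℝ, 0 < K ∧ ∀ N : ℕ, 1 ≤ N → ∀ t : ℝ, 0 ≤ t → t ≤ K * 2 ^ N → Confined C β η N t := by
  set x : ℝ := 2 ^ ((2 - β) / 4) with hxdef
  have hx0 : 0 < x := by positivity
  have hx1 : x < 1 := Real.rpow_lt_one_of_one_lt_of_neg (by norm_num) (by linarith)
  have hx : 0 < 1 - x := by linarith
  refine ⟨η * (1 - x) ^ 3 / (64 * Real.exp 1 ^ 2 * C), by positivity, fun N hN t ht htK => ?_⟩
  refine confined_of_geometric hC hη hη1 hx0 hx1 hN (e := fun q => (q : ℕ) + 1)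
    (fun q q' h => Fin.ext (by simpa using h)) ht fun q => ?_
  have hpow : ((2 : ℝ) ^ ((q : ℕ) + 1)) ^ (2 - β) = (x ^ 4) ^ ((q : ℕ) + 1) := by
    rw [hxdef, ← Real.rpow_natCast, ← Real.rpow_natCast, ← Real.rpow_natCast, ← Real.rpow_mul,
      ← Real.rpow_mul, ← Real.rpow_mul] <;> try positivity
    congr 1; push_cast; ring
  rw [hpow, mul_div_right_comm]
  refine mul_le_mul_of_nonneg_right ?_ (by positivity)
  rwa [div_le_iff₀ (by positivity)]

/-- Here the longest scale dominates, and `e` counts the scales down from it. -/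
theorem exists_confined_of_lt_two (hC : 0 < C) (hβ : β < 2) {η : ℝ} (hη : 0 < η) (hη1 : η ≤ 1) :
    ∃ K : ℝ, 0 < K ∧ ∀ N : ℕ, 1 ≤ N → ∀ t : ℝ, 0 ≤ t → t ≤ K * ((2 : ℝ) ^ N) ^ (β - 1) →
      Confined C β η N t := by
  set x : ℝ := 2 ^ ((β - 2) / 4) with hxdef
  have hx0 : 0 < x := by positivity
  have hx1 : x < 1 := Real.rpow_lt_one_of_one_lt_of_neg (by norm_num) (by linarith)
  have hx : 0 < 1 - x := by linarith
  refine ⟨η * (1 - x) ^ 3 / (64 * Real.exp 1 ^ 2 * C), by positivity, fun N hN t ht htK => ?_⟩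
  refine confined_of_geometric hC hη hη1 hx0 hx1 hN (e := fun q => N - 1 - (q : ℕ))
    (fun q q' h => Fin.ext (by have := q.2; have := q'.2; simp only at h; omega)) ht fun q => ?_
  have hpow : ((2 : ℝ) ^ ((q : ℕ) + 1)) ^ (2 - β) =
      ((2 : ℝ) ^ N) ^ (2 - β) * (x ^ 4) ^ (N - 1 - (q : ℕ)) := by
    have h1 : x ^ 4 = 2 ^ (β - 2) := by
      rw [hxdef, ← Real.rpow_natCast, ← Real.rpow_mul (by norm_num)]
      congr 1; push_cast; ring
    have h2 : (x ^ 4) ^ (N - 1 - (q : ℕ)) = ((2 : ℝ) ^ (N - 1 - (q : ℕ))) ^ (β - 2) := by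
      rw [h1, ← Real.rpow_natCast, ← Real.rpow_natCast, ← Real.rpow_mul (by norm_num),
        ← Real.rpow_mul (by norm_num)]
      congr 1; ring
    rw [h2, ← two_pow_split q, Real.mul_rpow (by positivity) (by positivity), mul_assoc,
      ← Real.rpow_add (by positivity)]
    simp
  have hN2 : ((2 : ℝ) ^ N) ^ (2 - β) / 2 ^ N = (((2 : ℝ) ^ N) ^ (β - 1))⁻¹ := by
    rw [← Real.rpow_neg (by positivity), ← Real.rpow_sub_one (by positivity)]
    congr 1; ring
  rw [hpow]
  calc t * (((2 : ℝ) ^ N) ^ (2 - β) * (x ^ 4) ^ (N - 1 - (q : ℕ))) / 2 ^ N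
      = t * (((2 : ℝ) ^ N) ^ (2 - β) / 2 ^ N) * (x ^ 4) ^ (N - 1 - (q : ℕ)) := by ring
    _ ≤ _ := by
      refine mul_le_mul_of_nonneg_right ?_ (by positivity)
      rw [hN2, ← div_eq_mul_inv, div_le_iff₀ (by positivity)]
      exact htK

theorem sum_min_dyadic_le {u : ℝ} (hu : 0 < u) (N : ℕ) :
    ∑ j ∈ Finset.range N, min (u * 2 ^ j) (u * 2 ^ j)⁻¹ ≤ 3 := by
  -- A potential with values between `0` and `3` on positive reals; doubling its argument raises it
  -- by at least `min v v⁻¹`, so the sum telescopes.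
  set φ : ℝ → ℝ := fun v => if v ≤ 1 then v else 3 - 2 / v with hφ
  have hstep : ∀ v : ℝ, 0 < v → min v v⁻¹ ≤ φ (v * 2) - φ v := by
    intro v hv
    simp only [hφ]
    split_ifs with h1 h2 h2
    · linarith [min_le_left v v⁻¹]
    · exfalso; linarith
    · refine (min_le_left _ _).trans ?_
      have h3 : 2 / (v * 2) = v⁻¹ := by field_simp
      rw [h3]
      have h4 : v * v⁻¹ = 1 := mul_inv_cancel₀ hv.ne'
      have h5 : v⁻¹ ≤ 2 := by
        rw [inv_le_comm₀ hv (by norm_num)]; linarith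
      have h6 : 1 ≤ v⁻¹ := one_le_inv₀ hv |>.2 h2
      nlinarith
    · refine (min_le_right _ _).trans ?_
      have h3 : 2 / (v * 2) = v⁻¹ := by field_simp
      have h4 : 2 / v = 2 * v⁻¹ := div_eq_mul_inv _ _
      rw [h3, h4]; linarith
  have hφ0 : 0 ≤ φ u := by
    simp only [hφ]
    split_ifs with h
    · exact hu.le
    · have : 2 / u ≤ 2 := div_le_self (by norm_num) (by linarith)
      linarith
  have hφ3 : ∀ v, 0 < v → φ v ≤ 3 := by
    intro v hv
    simp only [hφ]
    split_ifs with h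
    · linarith
    · have : 0 < 2 / v := by positivity
      linarith
  have hind : ∑ j ∈ Finset.range N, min (u * 2 ^ j) (u * 2 ^ j)⁻¹ ≤ φ (u * 2 ^ N) - φ u := by
    induction N with
    | zero => simp
    | succ N ih =>
      rw [Finset.sum_range_succ, pow_succ, ← mul_assoc]
      have := hstep (u * 2 ^ N) (by positivity)
      linarith
  have := hφ3 (u * 2 ^ N) (by positivity)
  linarith

/-- All scales get the same fraction, so `z` has order `t N² / 2^N`. Bounding each weight by `z`
alone would cost a further factor `N` in the sum; the weights are in fact concentrated at the scales
with `u` of order `1`. -/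
theorem exists_confined_two (hC : 0 < C) {η : ℝ} (hη : 0 < η) (hη1 : η ≤ 1) :
    ∃ K : ℝ, 0 < K ∧ ∀ N : ℕ, 1 ≤ N → ∀ t : ℝ, 0 ≤ t → t ≤ K * (2 ^ N / (N : ℝ) ^ 2) →
      Confined C 2 η N t := by
  refine ⟨η / (192 * Real.exp 1 ^ 2 * C), by positivity, fun N hN t ht htK => ?_⟩
  have hN' : (0 : ℝ) < N := by exact_mod_cast hN
  set ρ : ℝ := 1 / (4 * N) with hρdef
  have hρ : 0 < ρ := by positivity
  have hρsum : ∑ _q : Fin N, ρ ≤ 1 / 4 := by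
    rw [Finset.sum_const, Finset.card_univ, Fintype.card_fin, nsmul_eq_mul, hρdef]
    refine le_of_eq ?_
    field_simp
  refine ⟨fun q => ⌊ρ * 2 ^ (N - 1 - (q : ℕ))⌋₊ + 1, sum_cap_lt hN (fun _ => hρ) hρsum, ?_⟩
  set z : ℝ := 4 * Real.exp 1 ^ 2 * C * (t / 2 ^ N) / ρ ^ 2 with hz
  have hz0 : 0 ≤ z := by positivity
  have hzη : z ≤ η / 3 := by
    have h1 : z = 64 * Real.exp 1 ^ 2 * C * (t * N ^ 2 / 2 ^ N) := by
      rw [hz, hρdef]; field_simp; ring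
    have h2 : t * (N : ℝ) ^ 2 / 2 ^ N ≤ η / (192 * Real.exp 1 ^ 2 * C) := by
      rw [div_le_iff₀ (by positivity)]
      have := mul_le_mul_of_nonneg_right htK (by positivity : (0 : ℝ) ≤ (N : ℝ) ^ 2)
      refine this.trans_eq ?_
      field_simp
    rw [h1]
    refine (mul_le_mul_of_nonneg_left h2 (by positivity)).trans_eq ?_
    field_simp
    norm_num
  have hterm : ∀ q : Fin N, ((2 ^ (N - (q : ℕ))).choose (⌊ρ * 2 ^ (N - 1 - (q : ℕ))⌋₊ + 1) : ℝ) *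
      orderedWeight (rate C 2 q) (⌊ρ * 2 ^ (N - 1 - (q : ℕ))⌋₊ + 1) t ≤
        z * min (ρ * 2 ^ (N - 1 - (q : ℕ))) (ρ * 2 ^ (N - 1 - (q : ℕ)))⁻¹ := by
    intro q
    set u := ρ * 2 ^ (N - 1 - (q : ℕ)) with hu
    set c := ⌊u⌋₊ + 1 with hc
    have hu0 : 0 < u := by positivity
    have hcu : u ≤ (c : ℝ) := by
      have := (Nat.lt_floor_add_one u).le
      rw [hc]; push_cast; exact this
    have hc1 : (1 : ℝ) ≤ c := by rw [hc]; push_cast; linarith [Nat.cast_nonneg (α := ℝ) ⌊u⌋₊]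
    have hw := weight_le (β := 2) hC ht q hρ (c := c) (by omega)
    rw [sub_self, Real.rpow_zero, mul_one, ← hz, ← hu] at hw
    refine hw.trans ?_
    have hz1 : z ≤ 1 / 2 := by linarith
    have hb0 : 0 ≤ z * (u ^ 2 / (c : ℝ) ^ 2) := by positivity
    rcases le_total u 1 with h1 | h1
    · have hinv : 1 ≤ u⁻¹ := (one_le_inv₀ hu0).2 h1
      rw [min_eq_left (h1.trans hinv)]
      have h2 : u ^ 2 / (c : ℝ) ^ 2 ≤ u := by
        rw [div_le_iff₀ (by positivity)]
        have : 1 ≤ (c : ℝ) ^ 2 := one_le_pow₀ hc1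
        nlinarith
      have h3 : z * (u ^ 2 / (c : ℝ) ^ 2) ≤ z * u := mul_le_mul_of_nonneg_left h2 hz0
      refine (pow_le_of_le_one hb0 (h3.trans ?_) (by omega)).trans h3
      nlinarith
    -- With many allowed records the high power helps: `z^c ≤ z 2^(-⌊u⌋) ≤ z / u`.
    · have hinv : u⁻¹ ≤ 1 := inv_le_one_of_one_le₀ h1
      rw [min_eq_right (hinv.trans h1)]
      have h2 : u ^ 2 / (c : ℝ) ^ 2 ≤ 1 := by
        rw [div_le_one (by positivity)]
        exact pow_le_pow_left₀ hu0.le hcu 2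
      have h3 : z * (u ^ 2 / (c : ℝ) ^ 2) ≤ z := mul_le_of_le_one_right hz0 h2
      refine (pow_le_pow_left₀ hb0 h3 c).trans ?_
      rw [hc, pow_succ']
      refine mul_le_mul_of_nonneg_left ?_ hz0
      refine (pow_le_pow_left₀ hz0 hz1 _).trans ?_
      rw [one_div, inv_pow]
      refine inv_anti₀ hu0 (hcu.trans ?_)
      rw [hc]
      exact_mod_cast Nat.lt_two_pow_self (n := ⌊u⌋₊)
  refine (Finset.sum_le_sum fun q _ => hterm q).trans ?_
  rw [← Finset.mul_sum, Fin.sum_univ_eq_sum_range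
    (fun j => min (ρ * 2 ^ (N - 1 - j)) (ρ * 2 ^ (N - 1 - j))⁻¹) N,
    Finset.sum_range_reflect (fun j => min (ρ * 2 ^ j) (ρ * 2 ^ j)⁻¹) N]
  have h3 := mul_le_mul_of_nonneg_left (sum_min_dyadic_le hρ N) hz0
  linarith

end Weights

/-! ### From confinement to the scrambling time -/

theorem prod_one_add_sub_one_le {ι : Type*} (s : Finset ι) {ε : ι → ℝ} (hε : ∀ q ∈ s, 0 ≤ ε q)
    {η : ℝ} (hη1 : η ≤ 1) (hsum : ∑ q ∈ s, ε q ≤ η) : ∏ q ∈ s, (1 + ε q) - 1 ≤ 2 * η := by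
  have h0 : 0 ≤ ∑ q ∈ s, ε q := Finset.sum_nonneg hε
  have h1 : ∏ q ∈ s, (1 + ε q) ≤ Real.exp (∑ q ∈ s, ε q) := by
    rw [Real.exp_sum]
    refine Finset.prod_le_prod (fun q hq => by have := hε q hq; positivity) fun q _ => ?_
    rw [add_comm]; exact Real.add_one_le_exp _
  have h2 := Real.abs_exp_sub_one_le (x := ∑ q ∈ s, ε q) (by rw [abs_of_nonneg h0]; linarith)
  rw [abs_of_nonneg h0] at h2
  have h3 := (abs_le.1 h2).2
  linarith

namespace Hamiltonian

variable {d : ℤ → ℕ} {H : Hamiltonian d}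

/-- Total weight `δ/8` makes the product exceed `1` by at most `δ/4`, and the commutator doubles
this to `δ/2`. The bound is uniform in `Λ`, hence holds for the upper limit, and stays strictly
below `δ`. -/
theorem growth_lt {C β δ : ℝ} (hC : 0 < C) (hδ : 0 < δ) (hδ2 : δ < 2) {N : ℕ} (hN : 1 ≤ N)
    (hblock : ∀ (Λ : Finset ℤ) (a : ℤ) (q k : ℕ), 1 ≤ q →
      ‖H.block Λ a (2 ^ N) q k‖ ≤ C * ((2 : ℝ) ^ q) ^ (1 - β))
    {i j : ℤ} (hij : (2 : ℤ) ^ N ≤ j - i + 1) {t : ℝ} (hconf : Confined C β (δ / 8) N |t|) :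
    H.growth i j t < ENNReal.ofReal δ := by
  obtain ⟨cap, hcap, hsum⟩ := hconf
  have hprod := prod_one_add_sub_one_le Finset.univ (fun q _ => mul_nonneg (Nat.cast_nonneg _)
    (orderedWeight_nonneg (by unfold rate; positivity) (abs_nonneg t) _)) (by linarith) hsum
  have hle : H.growth i j t ≤ ENNReal.ofReal (δ / 2) := by
    refine iSup_le fun A => iSup_le fun hA => iSup_le fun B => iSup_le fun ⟨F, hF, hB⟩ => ?_
    refine Filter.limsup_le_of_le (h := Filter.Eventually.of_forall fun Λ => ?_)
    refine ENNReal.ofReal_le_ofReal (div_le_of_le_mul₀ (by positivity) (by positivity) ?_)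
    have hB' : ActsOn (Set.Ici (i + 2 ^ N - 1)) B := hB.mono fun k hk => by
      have := hF k hk
      simp only [Set.mem_Ici]
      omega
    refine (H.norm_commutator_le (Λ := Λ) hN
      (b := fun q => C * ((2 : ℝ) ^ ((q : ℕ) + 1)) ^ (1 - β)) (fun q => by positivity)
      (fun q k => hblock Λ i _ k (by omega)) cap hcap hA hB' t).trans ?_
    have := mul_le_mul_of_nonneg_left hprod (by positivity : 0 ≤ 2 * (‖A‖ * ‖B‖))
    refine this.trans_eq ?_
    ring
  exact hle.trans_lt ((ENNReal.ofReal_lt_ofReal_iff hδ).2 (by linarith))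

end Hamiltonian

/-- A time up to which the front is confined to a segment of `2^N ≤ r + 1` sites is a lower bound
for the scrambling time. -/
theorem exists_le_scramblingTime {α h δ κ β : ℝ} (hδ : 0 < δ) (hδ2 : δ < 2) (hκ : 0 < κ)
    (hβ : 1 < β) {τ : ℝ → ℕ → ℝ} (hτ : ∀ C : ℝ, 0 < C → ∃ K : ℝ, 0 < K ∧ ∀ N : ℕ, 1 ≤ N →
      ∀ t : ℝ, 0 ≤ t → t ≤ τ K N → Confined C β (δ / 8) N t) :
    ∃ K : ℝ, 0 < K ∧ ∀ (d : ℤ → ℕ) [∀ i, NeZero (d i)] (H : Hamiltonian d), H.PowerLaw α h →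
      H.effExponent κ α = β → ∀ r : ℕ, 1 ≤ r →
        ENNReal.ofReal (τ K (Nat.log 2 (r + 1))) ≤ H.scramblingTime δ r := by
  obtain ⟨C, hC, hblock⟩ := exists_norm_block_le α h hκ
  obtain ⟨K, hK, hconf⟩ := hτ C hC
  refine ⟨K, hK, fun d _ H hH heff r hr => le_sSup ?_⟩
  intro i j _ hr' t _ htT
  have hN : 1 ≤ Nat.log 2 (r + 1) := Nat.log_pos (by norm_num) (by omega)
  refine Hamiltonian.growth_lt hC hδ hδ2 hN (fun Λ a q k hq => ?_) ?_
    (hconf _ hN |t| (abs_nonneg t) ?_)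
  · rw [← heff]
    exact hblock d H hH (by rw [heff]; exact hβ) Λ a _ q k hN hq
  · have h1 : 2 ^ Nat.log 2 (r + 1) ≤ r + 1 := Nat.pow_log_le_self 2 (by omega)
    rw [hr']
    exact_mod_cast h1
  -- For a nonpositive `τ` the truncation by `ENNReal.ofReal` leaves no admissible `t`.
  · rcases le_or_gt (τ K (Nat.log 2 (r + 1))) 0 with h0 | h0
    · rw [ENNReal.ofReal_of_nonpos h0] at htT
      exact absurd htT not_lt_zero
    · exact ((ENNReal.ofReal_lt_ofReal_iff h0).1 htT).le

theorem half_le_two_pow_log (r : ℕ) : (r : ℝ) / 2 ≤ 2 ^ Nat.log 2 (r + 1) := by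
  have h := Nat.lt_pow_succ_log_self (b := 2) (by norm_num) (r + 1)
  have h1 : ((r + 1 : ℕ) : ℝ) < ((2 ^ (Nat.log 2 (r + 1)).succ : ℕ) : ℝ) := by exact_mod_cast h
  push_cast at h1
  rw [pow_succ] at h1
  linarith

/-- For `r ≥ 2`, `2^N ≤ r + 1 ≤ r²`, and `log 2 > 1/2` gives `N ≤ 4 log r`. -/
theorem log_two_sq_le {r : ℕ} (hr : 2 ≤ r) :
    ((Nat.log 2 (r + 1) : ℕ) : ℝ) ^ 2 ≤ 16 * Real.log r ^ 2 := by
  set N := Nat.log 2 (r + 1)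
  have hr' : (2 : ℝ) ≤ r := by exact_mod_cast hr
  have h1 : 2 ^ N ≤ r + 1 := Nat.pow_log_le_self 2 (by omega)
  have h2 : (2 : ℝ) ^ N ≤ (r : ℝ) ^ 2 := by
    have : (2 : ℝ) ^ N ≤ r + 1 := by exact_mod_cast h1
    nlinarith
  have h3 := Real.log_le_log (by positivity) h2
  rw [Real.log_pow, Real.log_pow] at h3
  have h4 := Real.log_two_gt_d9
  have h5 : (N : ℝ) * (1 / 2) ≤ N * Real.log 2 :=
    mul_le_mul_of_nonneg_left (by linarith) (Nat.cast_nonneg N)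
  push_cast at h3
  have h6 : (N : ℝ) ≤ 4 * Real.log r := by linarith
  calc (N : ℝ) ^ 2 ≤ (4 * Real.log r) ^ 2 := pow_le_pow_left₀ (Nat.cast_nonneg N) h6 2
    _ = _ := by ring

/-- The lower bound for the scrambling time with a given effective exponent `β`. -/
theorem exists_scramblingTime_bound (α h δ κ β : ℝ) (hδ : 0 < δ) (hδ2 : δ < 2) (hκ : 0 < κ) :
    ∃ K : ℝ, 0 < K ∧ ∀ (d : ℤ → ℕ) [∀ i, NeZero (d i)] (H : Hamiltonian d), H.PowerLaw α h →
      H.effExponent κ α = β → ∀ r : ℕ, 1 ≤ r →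
        (1 < β → β < 2 → ENNReal.ofReal (K * (r : ℝ) ^ (β - 1)) ≤ H.scramblingTime δ r) ∧
        (β = 2 → 2 ≤ r → ENNReal.ofReal (K * ((r : ℝ) / Real.log r ^ 2)) ≤ H.scramblingTime δ r) ∧
        (2 < β → ENNReal.ofReal (K * r) ≤ H.scramblingTime δ r) := by
  have hη : 0 < δ / 8 := by positivity
  have hη1 : δ / 8 ≤ 1 := by linarith
  rcases le_or_gt β 1 with h1 | h1
  · exact ⟨1, one_pos, fun d _ H _ _ r _ =>
      ⟨fun h => absurd h (not_lt.2 h1), fun h => by linarith, fun h => by linarith⟩⟩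
  rcases lt_trichotomy β 2 with h2 | h2 | h2
  · obtain ⟨K, hK, hb⟩ := exists_le_scramblingTime (α := α) (h := h) hδ hδ2 hκ h1
      (τ := fun K N => K * ((2 : ℝ) ^ N) ^ (β - 1))
      fun C hC => exists_confined_of_lt_two hC h2 hη hη1
    refine ⟨K / 2, by positivity, fun d _ H hH heff r hr =>
      ⟨fun _ _ => ?_, fun h => absurd h h2.ne, fun h => absurd h (not_lt.2 h2.le)⟩⟩
    refine le_trans (ENNReal.ofReal_le_ofReal ?_) (hb d H hH heff r hr)
    have h3 : ((r : ℝ) / 2) ^ (β - 1) ≤ ((2 : ℝ) ^ Nat.log 2 (r + 1)) ^ (β - 1) :=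
      Real.rpow_le_rpow (by positivity) (half_le_two_pow_log r) (by linarith)
    -- Since `β - 1 ≤ 1`, halving `r` loses at most a factor `2`.
    have h4 : (r : ℝ) ^ (β - 1) / 2 ≤ ((r : ℝ) / 2) ^ (β - 1) := by
      rw [Real.div_rpow (by positivity) (by norm_num)]
      refine div_le_div_of_nonneg_left (by positivity) (by positivity) ?_
      calc (2 : ℝ) ^ (β - 1) ≤ 2 ^ (1 : ℝ) :=
            Real.rpow_le_rpow_of_exponent_le (by norm_num) (by linarith)
        _ = 2 := Real.rpow_one 2
    have := mul_le_mul_of_nonneg_left (h4.trans h3) hK.le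
    linarith
  · subst h2
    obtain ⟨K, hK, hb⟩ := exists_le_scramblingTime (α := α) (h := h) hδ hδ2 hκ h1
      (τ := fun K N => K * ((2 : ℝ) ^ N / (N : ℝ) ^ 2))
      fun C hC => exists_confined_two hC hη hη1
    refine ⟨K / 32, by positivity, fun d _ H hH heff r hr =>
      ⟨fun _ h => absurd h (lt_irrefl _), fun _ hr2 => ?_, fun h => absurd h (lt_irrefl _)⟩⟩
    refine le_trans (ENNReal.ofReal_le_ofReal ?_) (hb d H hH heff r hr)
    have hN : 1 ≤ Nat.log 2 (r + 1) := Nat.log_pos (by norm_num) (by omega)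
    have hN' : (0 : ℝ) < (Nat.log 2 (r + 1) : ℕ) := by exact_mod_cast hN
    have h3 : (r : ℝ) / 2 / (16 * Real.log r ^ 2) ≤
        2 ^ Nat.log 2 (r + 1) / ((Nat.log 2 (r + 1) : ℕ) : ℝ) ^ 2 :=
      div_le_div₀ (by positivity) (half_le_two_pow_log r) (by positivity) (log_two_sq_le hr2)
    refine le_trans (le_of_eq ?_) (mul_le_mul_of_nonneg_left h3 hK.le)
    ring
  · obtain ⟨K, hK, hb⟩ := exists_le_scramblingTime (α := α) (h := h) hδ hδ2 hκ h1
      (τ := fun K N => K * (2 : ℝ) ^ N)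
      fun C hC => exists_confined_of_two_lt hC h2 hη hη1
    refine ⟨K / 2, by positivity, fun d _ H hH heff r hr =>
      ⟨fun _ h => absurd h (not_lt.2 h2.le), fun h => absurd h h2.ne', fun _ => ?_⟩⟩
    refine le_trans (ENNReal.ofReal_le_ofReal ?_) (hb d H hH heff r hr)
    have := mul_le_mul_of_nonneg_left (half_le_two_pow_log r) hK.le
    linarith

end LongRangeChain

open LongRangeChain in
theorem theorem1 (α h δ κ : ℝ) (hδ : 0 < δ) (hδ2 : δ < 2) (hκ : 0 < κ) :
    ∃ K : ℝ, 0 < K ∧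
      ∀ (d : ℤ → ℕ) [∀ i, NeZero (d i)] (H : Hamiltonian d), H.PowerLaw α h →
        ∀ r : ℕ, 1 ≤ r →
          (1 < H.effExponent κ α → H.effExponent κ α < 2 →
            ENNReal.ofReal (K * (r : ℝ) ^ (H.effExponent κ α - 1)) ≤ H.scramblingTime δ r) ∧
          (H.effExponent κ α = 2 → 2 ≤ r →
            ENNReal.ofReal (K * ((r : ℝ) / Real.log r ^ 2)) ≤ H.scramblingTime δ r) ∧
          (2 < H.effExponent κ α →
            ENNReal.ofReal (K * r) ≤ H.scramblingTime δ r) ∧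
          (3 < α → ENNReal.ofReal (K * r) ≤ H.scramblingTime δ r) ∧
          (2 < α → H.FrustratedWith κ → ENNReal.ofReal (K * r) ≤ H.scramblingTime δ r) := by
  -- For given `α` the effective exponent takes only the values `α` and `α - 1`, so the smaller of
  -- two constants serves every Hamiltonian.
  obtain ⟨K₁, hK₁, hb₁⟩ := exists_scramblingTime_bound α h δ κ α hδ hδ2 hκ
  obtain ⟨K₂, hK₂, hb₂⟩ := exists_scramblingTime_bound α h δ κ (α - 1) hδ hδ2 hκ
  refine ⟨min K₁ K₂, lt_min hK₁ hK₂, fun d _ H hH r hr => ?_⟩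
  have hmono : ∀ {K' x : ℝ}, min K₁ K₂ ≤ K' → 0 ≤ x →
      ENNReal.ofReal (K' * x) ≤ H.scramblingTime δ r →
      ENNReal.ofReal (min K₁ K₂ * x) ≤ H.scramblingTime δ r := fun hK' hx hle =>
    (ENNReal.ofReal_le_ofReal (mul_le_mul_of_nonneg_right hK' hx)).trans hle
  have hr0 : (0 : ℝ) ≤ r := Nat.cast_nonneg r
  by_cases hf : H.FrustratedWith κ
  · have heff : H.effExponent κ α = α := if_pos hf
    obtain ⟨c1, c2, c3⟩ := hb₁ d H hH heff r hr
    rw [heff]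
    have hlin : 2 < α → ENNReal.ofReal (min K₁ K₂ * r) ≤ H.scramblingTime δ r :=
      fun h => hmono (min_le_left _ _) hr0 (c3 h)
    exact ⟨fun h h' => hmono (min_le_left _ _) (by positivity) (c1 h h'),
      fun h h' => hmono (min_le_left _ _) (by positivity) (c2 h h'), hlin,
      fun h => hlin (by linarith), fun h _ => hlin h⟩
  · have heff : H.effExponent κ α = α - 1 := if_neg hf
    obtain ⟨c1, c2, c3⟩ := hb₂ d H hH heff r hr
    rw [heff]
    have hlin : 2 < α - 1 → ENNReal.ofReal (min K₁ K₂ * r) ≤ H.scramblingTime δ r :=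
      fun h => hmono (min_le_right _ _) hr0 (c3 h)
    exact ⟨fun h h' => hmono (min_le_right _ _) (by positivity) (c1 h h'),
      fun h h' => hmono (min_le_right _ _) (by positivity) (c2 h h'), hlin,
      fun h => hlin (by linarith), fun _ h => absurd h hf⟩
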